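/- Let $K$ be a field, let $n \ge 0$, and let $G$ be a chordal graph on the vertex set $[n]=\{1,\dots,n\}$, that is, a finite simple graph in which each cycle of length $>3$ has a chord. Let $\Delta(G)$ be the clique complex of $G$, whose faces are the cliques of $G$; a vertex is called free if it belongs to exactly one facet (inclusion-maximal face) of $\Delta(G)$. Let $F_1,\dots,F_m$ be the distinct facets of $\Delta(G)$ that contain a free vertex. For a field $k$, let $I_k(G)=(x_ix_j : \{i,j\}\in E(G))\subset k[x_1,\dots,x_n]$ be the edge ideal of $G$; $G$ is called Cohen–Macaulay over $k$ if the ring $k[x_1,\dots,x_n]/I_k(G)$ is Cohen–Macaulay, and Cohen–Macaulay if it is so over every field $k$. $G$ is called unmixed if all its inclusion-minimal vertex covers have the same cardinality. Given a finite simple graph $H$ (possibly with no vertices), a partition of $V(H)$ into pairwise disjoint, possibly empty, cliques $A_1,\dots,A_r$ of $H$ ($r\ge 0$), and non-empty finite sets $B_1,\dots,B_r$ that are disjoint from each other and from $V(H)$, let $H_{A_1,\dots,A_r}^{B_1,\dots,B_r}$ be the graph on the vertex set $V(H)\cup B_1\cup\dots\cup B_r$ whose edges are the edges of $H$ together with all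 two-element subsets of $A_i\cup B_i$ for $i=1,\dots,r$. A graph is called hybrid if it is isomorphic to such a graph $H_{A_1,\dots,A_r}^{B_1,\dots,B_r}$. Then the following are equivalent: 1. $G$ is Cohen–Macaulay; 2. $G$ is Cohen–Macaulay over $K$; 3. $G$ is unmixed; 4. $[n]$ is the disjoint union of $F_1,\dots,F_m$; 5. $G$ is a hybrid graph. -/

import Mathlib

universe u v

/-! ### Cohen-Macaulay rings -/

/-- A local ring is Cohen-Macaulay if it is Noetherian and its depth equals its Krull dimension.
Regular sequences in a Noetherian local ring never have more than `dim R` elements, so this says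
that the maximal ideal contains a regular sequence with exactly `dim R` elements. -/
def IsCohenMacaulayLocalRing (R : Type*) [CommRing R] [IsLocalRing R] : Prop :=
  IsNoetherianRing R ∧
    ∃ rs : List R, (∀ r ∈ rs, r ∈ IsLocalRing.maximalIdeal R) ∧
      RingTheory.Sequence.IsRegular R rs ∧ (rs.length : WithBot ℕ∞) = ringKrullDim R

/-- A commutative ring is Cohen-Macaulay if it is Noetherian and all its localizations at maximal
ideals are Cohen-Macaulay local rings. -/
def IsCohenMacaulayRing (R : Type*) [CommRing R] : Prop :=
  IsNoetherianRing R ∧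
    ∀ (m : Ideal R) [m.IsMaximal], IsCohenMacaulayLocalRing (Localization.AtPrime m)

/-! ### Simplicial complexes -/

namespace AbstractSimplicialComplex

variable {V : Type*}

/-- The facets of a simplicial complex are its inclusion-maximal faces. -/
def IsFacet (Δ : AbstractSimplicialComplex V) (F : Finset V) : Prop :=
  Maximal (fun s : Finset V => s ∈ Δ) F

/-- A free vertex is a vertex that belongs to exactly one facet. -/
def IsFreeVertex (Δ : AbstractSimplicialComplex V) (x : V) : Prop :=
  ∃! F : Finset V, Δ.IsFacet F ∧ x ∈ F

/-- The set of all facets that admit a free vertex. -/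
def freeFacets (Δ : AbstractSimplicialComplex V) : Set (Finset V) :=
  {F | Δ.IsFacet F ∧ ∃ x ∈ F, Δ.IsFreeVertex x}

end AbstractSimplicialComplex

/-! ### Graphs -/

namespace SimpleGraph

variable {V : Type*}

/-- The clique complex: its faces are the (nonempty, finite) cliques. -/
def cliqueComplex (G : SimpleGraph V) : AbstractSimplicialComplex V where
  faces := {s | s.Nonempty ∧ G.IsClique (s : Set V)}
  isRelLowerSet_faces := by
    rintro s ⟨hs, hc⟩
    exact ⟨hs, fun t hts ht => ⟨ht, hc.subset (by exact_mod_cast hts)⟩⟩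
  singleton_mem := fun x => ⟨Finset.singleton_nonempty x, by simp⟩

/-- A graph is chordal if each cycle of length greater than three has a chord, that is, two of
its vertices are joined by an edge of the graph that is not an edge of the cycle. -/
def IsChordal (G : SimpleGraph V) : Prop :=
  ∀ (w : V) (c : G.Walk w w), c.IsCycle → 3 < c.length →
    ∃ i ∈ c.support, ∃ j ∈ c.support, G.Adj i j ∧ s(i, j) ∉ c.edges

/-- A graph is unmixed if all its (inclusion-)minimal vertex covers have the same cardinality. -/
def IsUnmixed (G : SimpleGraph V) : Prop :=
  ∀ C D : Set V, Minimal G.IsVertexCover C → Minimal G.IsVertexCover D → C.encard = D.encard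

/-- The edge ideal, generated by the monomials `x_i x_j` with `{i, j}` an edge. -/
noncomputable def edgeIdeal (G : SimpleGraph V) (K : Type*) [Field K] :
    Ideal (MvPolynomial V K) :=
  Ideal.span {p | ∃ i j : V, G.Adj i j ∧ p = MvPolynomial.X i * MvPolynomial.X j}

/-- `G` is Cohen-Macaulay over the field `K`. -/
def IsCohenMacaulayOver (G : SimpleGraph V) (K : Type*) [Field K] : Prop :=
  IsCohenMacaulayRing (MvPolynomial V K ⧸ G.edgeIdeal K)

/-- `G` is Cohen-Macaulay, that is, Cohen-Macaulay over every field (in an arbitrary universe). -/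
def IsCohenMacaulay.{w, t} {W : Type t} (G : SimpleGraph W) : Prop :=
  ∀ (k : Type w) [Field k], G.IsCohenMacaulayOver k

/-- The set `A_i ∪ B_i`, where `B_i = {y_{i,1}, …, y_{i,s_i}}` consists of the `s i` new vertices
`Sum.inr ⟨i, _⟩`. -/
def hybridBlock {r : ℕ} (A : Fin r → Set V) (s : Fin r → ℕ) (i : Fin r) :
    Set (V ⊕ (Σ i : Fin r, Fin (s i))) :=
  Sum.inl '' A i ∪ Sum.inr '' {y | y.1 = i}

/-- The graph `H_{A_1, …, A_r}^{B_1, …, B_r}`: the vertices are those of `H` together with those of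
`B_1, …, B_r`; the edges are those of `H` together with all two-element subsets of each
`A_i ∪ B_i`. -/
def hybridGraph (H : SimpleGraph V) {r : ℕ} (A : Fin r → Set V) (s : Fin r → ℕ) :
    SimpleGraph (V ⊕ (Σ i : Fin r, Fin (s i))) where
  Adj a b := (∃ x y, a = Sum.inl x ∧ b = Sum.inl y ∧ H.Adj x y) ∨
    (a ≠ b ∧ ∃ i, a ∈ hybridBlock A s i ∧ b ∈ hybridBlock A s i)
  symm := ⟨by
    rintro a b (⟨x, y, ha, hb, h⟩ | ⟨hab, i, ha, hb⟩)
    · exact Or.inl ⟨y, x, hb, ha, h.symm⟩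
    · exact Or.inr ⟨hab.symm, i, hb, ha⟩⟩
  loopless := ⟨by
    rintro a (⟨x, y, ha, hb, h⟩ | ⟨hab, -⟩)
    · exact h.ne (Sum.inl_injective (ha.symm.trans hb))
    · exact hab rfl⟩

/-- `A_1, …, A_r` are pairwise disjoint cliques of `H`, possibly empty, that cover the vertex
set. -/
def IsCliquePartition (H : SimpleGraph V) {r : ℕ} (A : Fin r → Set V) : Prop :=
  (∀ i, H.IsClique (A i)) ∧ (∀ i j, i ≠ j → Disjoint (A i) (A j)) ∧ (⋃ i, A i) = Set.univ

/-- A graph is hybrid if, up to renaming of its vertices, it is the graph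
`H_{A_1, …, A_r}^{B_1, …, B_r}` for some finite graph `H`, some partition of the vertices of `H`
into cliques `A_1, …, A_r`, and some nonempty finite sets `B_1, …, B_r` of new vertices. -/
def IsHybrid (G : SimpleGraph V) : Prop :=
  ∃ (n : ℕ) (H : SimpleGraph (Fin n)) (r : ℕ) (A : Fin r → Set (Fin n)) (s : Fin r → ℕ),
    H.IsCliquePartition A ∧ (∀ i, 0 < s i) ∧ Nonempty (G ≃g H.hybridGraph A s)

end SimpleGraph

/-! Conditions 1 and 2 each imply 3, then 3 → 4 → 5, and 5 gives back 1 and 2.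

Unmixed to partition: complements of minimal vertex covers are maximal independent sets, so all of
these have one size. Facets with a free vertex are the closed neighbourhoods of simplicial vertices.
If these neighbourhoods missed a vertex, or two distinct ones met, there would be an independent set
larger than some maximal one. Dirac's lemma (`IsChordal.exists_simplicial`) and the dominating sets
of `IsChordal.exists_isIndepSet_dominating` supply the sets to compare.

Cohen–Macaulay to unmixed: let `A` be the local ring at the irrelevant ideal. Its dimension is at
least `|V \ D|` for every vertex cover `D`, while its depth is at most `dim A/q` for every
associated prime `q`, and each minimal cover `C` provides a `q` with `dim A/q ≤ |V \ C|`.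

Hybrid to Cohen–Macaulay: a hybrid graph is a partition into `m` cliques, each with a vertex `b i`
having no neighbours outside its clique (`IsCliqueWhiskered`). The edge ring has dimension at most
`m`, and the `m` clique sums form a regular sequence: exact sequences that delete a vertex or its
neighbours reduce this to a polynomial ring. At other maximal ideals the clique sums are replaced by
monic polynomials in them. -/

namespace SimpleGraph

/-! ### Chordal graphs: simplicial vertices and dominating independent sets. -/

variable {V : Type*} {G : SimpleGraph V}

/-- In a chordal graph, two neighbours of `x` that are joined by a path whose inner vertices are
neither equal nor adjacent to `x` are adjacent. -/
theorem IsChordal.adj_of_isPath (hG : G.IsChordal) {x s t : V} (hs : G.Adj x s) (ht : G.Adj x t)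
    (hst : s ≠ t) (n : ℕ) : ∀ p : G.Walk s t, p.length = n → p.IsPath →
      (∀ v ∈ p.support, v ≠ x ∧ (G.Adj x v → v = s ∨ v = t)) → G.Adj s t := by
  classical
  induction n using Nat.strong_induction_on with
  | _ n ih =>
  intro p hn hp hx
  by_contra hadj
  have h2 : 2 ≤ p.length := by
    by_contra! h
    interval_cases hl : p.length
    · exact hst (Walk.eq_of_length_eq_zero hl)
    · exact hadj (Walk.adj_of_length_eq_one hl)
  have hxp : x ∉ p.support := fun h => (hx x h).1 rfl
  have hcyc : (Walk.cons hs (p.concat ht.symm)).IsCycle := by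
    rw [Walk.cons_isCycle_iff]
    refine ⟨hp.concat hxp ht.symm, ?_⟩
    rw [Walk.edges_concat]
    simp only [List.concat_eq_append, List.mem_append, List.mem_singleton, not_or]
    refine ⟨fun h => hxp (p.fst_mem_support_of_mem_edges h), ?_⟩
    intro h
    rw [Sym2.eq_iff] at h
    rcases h with h | h
    · exact ht.ne h.1
    · exact hst h.2
  -- A chord between two vertices of `p` gives a shorter path within the same support, so induction
  -- applies. A chord at `x` would have to end at `s` or `t`, but those edges belong to the cycle.
  have hshort : ∀ a b : ℕ, a < b → b ≤ p.length → G.Adj (p.getVert a) (p.getVert b) →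
      s(p.getVert a, p.getVert b) ∉ p.edges → False := by
    intro a b hab hb hadj' he
    have hb1 : b ≠ a + 1 := by
      rintro rfl
      exact he (Walk.adj_toSubgraph_iff_mem_edges.1 (p.toSubgraph_adj_getVert (by omega)))
    let q := (p.take a).append (Walk.cons hadj' (p.drop b))
    have hq : q.length < n := by
      simp only [q, Walk.length_append, Walk.length_cons, Walk.take_length, Walk.drop_length]
      omega
    have hqs : ∀ v ∈ q.support, v ∈ p.support := by
      intro v hv
      simp only [q, Walk.mem_support_append_iff, Walk.support_cons, List.mem_cons] at hv
      rcases hv with hv | rfl | hv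
      · rw [Walk.support_take] at hv
        exact List.mem_of_mem_take hv
      · exact p.getVert_mem_support a
      · rw [Walk.drop_support_eq_support_drop_min] at hv
        exact List.mem_of_mem_drop hv
    exact hadj (ih q.bypass.length (lt_of_le_of_lt q.length_bypass_le_length hq) q.bypass rfl
      q.bypass_isPath fun v hv => hx v (hqs v (q.support_bypass_subset_support hv)))
  have key : ∀ i ∈ p.support, ∀ j ∈ p.support, G.Adj i j → s(i, j) ∉ p.edges → False := by
    intro i hi j hj hij he
    obtain ⟨a, rfl, ha⟩ := Walk.mem_support_iff_exists_getVert.1 hi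
    obtain ⟨b, rfl, hb⟩ := Walk.mem_support_iff_exists_getVert.1 hj
    rcases lt_trichotomy a b with h | rfl | h
    · exact hshort a b h hb hij he
    · exact hij.ne rfl
    · exact hshort b a h ha hij.symm (by rwa [Sym2.eq_swap])
  obtain ⟨i, hi, j, hj, hij, he⟩ := hG x _ hcyc (by simp; omega)
  simp only [Walk.support_cons, Walk.support_concat, List.mem_cons, List.mem_append,
    List.not_mem_nil, or_false] at hi hj
  simp only [Walk.edges_cons, Walk.edges_concat, List.concat_eq_append, List.mem_cons,
    List.mem_append, List.not_mem_nil, or_false, not_or] at he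
  have hxj : ∀ j ∈ p.support, G.Adj x j → s(x, j) ≠ s(x, s) → s(x, j) ≠ s(t, x) → False := by
    intro j hj h h1 h2
    rcases (hx j hj).2 h with rfl | rfl
    · exact h1 rfl
    · exact h2 Sym2.eq_swap
  have hi' : i = x ∨ i ∈ p.support := by tauto
  have hj' : j = x ∨ j ∈ p.support := by tauto
  rcases hi' with rfl | hi' <;> rcases hj' with rfl | hj'
  · exact hij.ne rfl
  · exact hxj j hj' hij he.1 he.2.2
  · exact hxj i hi' hij.symm (by rw [Sym2.eq_swap]; exact he.1)
      (by rw [Sym2.eq_swap]; exact he.2.2)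
  · exact key i hi' j hj' hij he.2.1

theorem IsChordal.adj_of_walk (hG : G.IsChordal) {x s t : V} (hs : G.Adj x s) (ht : G.Adj x t)
    (hst : s ≠ t) (p : G.Walk s t)
    (hp : ∀ v ∈ p.support, v ≠ x ∧ (G.Adj x v → v = s ∨ v = t)) : G.Adj s t := by
  classical
  exact hG.adj_of_isPath hs ht hst _ p.bypass rfl p.bypass_isPath
    fun v hv => hp v (p.support_bypass_subset_support hv)

/-- Dirac's lemma: in an induced subgraph of a chordal graph, every proper clique misses a
simplicial vertex. -/
theorem IsChordal.exists_simplicial (hG : G.IsChordal) (U : Finset V) :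
    ∀ C ⊂ U, G.IsClique (C : Set V) → ∃ d ∈ U, d ∉ C ∧
      ∀ a ∈ U, ∀ b ∈ U, G.Adj d a → G.Adj d b → a ≠ b → G.Adj a b := by
  classical
  induction U using Finset.strongInduction with
  | H U ih =>
  intro C hCU hC
  by_cases hU : G.IsClique (U : Set V)
  · obtain ⟨d, hd, hdC⟩ := Finset.exists_of_ssubset hCU
    exact ⟨d, hd, hdC, fun a ha b hb _ _ h => hU ha hb h⟩
  obtain ⟨x, hxU, hxC, y, hyU, hyx, hxy⟩ : ∃ x ∈ U, (∀ c ∈ C, c ≠ x → G.Adj x c) ∧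
      ∃ y ∈ U, y ≠ x ∧ ¬ G.Adj x y := by
    by_cases h : ∃ x ∈ C, ∃ y ∈ U, y ≠ x ∧ ¬ G.Adj x y
    · obtain ⟨x, hx, h⟩ := h
      exact ⟨x, hCU.1 hx, fun c hc hcx => hC hx hc hcx.symm, h⟩
    · push Not at h
      simp only [IsClique, Set.Pairwise] at hU
      push Not at hU
      obtain ⟨x, hx, y, hy, hxy, hn⟩ := hU
      exact ⟨x, hx, fun c hc hcx => (h c hc x hx hcx.symm).symm, y, hy, hxy.symm, hn⟩
  let T : V → Prop := fun v => v ∈ U ∧ v ≠ x ∧ ¬ G.Adj x v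
  -- `D` is the component of `y` among the non-neighbours of `x`, and `S` is its boundary. Vertices
  -- of `S` are neighbours of `x` joined pairwise through `D`, so `S` is a clique. Induction on `D ∪
  -- S`, which misses `x`, yields `d ∈ D`; all neighbours of `d` in `U` lie in `D ∪ S`, so `d` is
  -- simplicial in `U`.
  let D := U.filter fun v => ∃ p : G.Walk y v, ∀ w ∈ p.support, T w
  let S := U.filter fun s => s ∉ D ∧ ∃ d ∈ D, G.Adj d s
  have hyD : y ∈ D := Finset.mem_filter.2 ⟨hyU, .nil, by simp [T, hyU, hyx, hxy]⟩
  have hDT : ∀ d ∈ D, T d := fun d hd => by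
    obtain ⟨-, p, hp⟩ := Finset.mem_filter.1 hd
    exact hp d p.end_mem_support
  have hDadj : ∀ d ∈ D, ∀ v, T v → G.Adj d v → v ∈ D := by
    intro d hd v hv hdv
    obtain ⟨-, p, hp⟩ := Finset.mem_filter.1 hd
    refine Finset.mem_filter.2 ⟨hv.1, p.concat hdv, fun w hw => ?_⟩
    simp only [Walk.support_concat, List.mem_append, List.mem_singleton] at hw
    rcases hw with hw | rfl
    exacts [hp w hw, hv]
  have hSx : ∀ s ∈ S, s ≠ x ∧ G.Adj x s := by
    intro s hs
    obtain ⟨hsU, hsD, d, hd, hds⟩ := Finset.mem_filter.1 hs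
    have h1 : s ≠ x := by
      rintro rfl
      exact (hDT d hd).2.2 hds.symm
    refine ⟨h1, ?_⟩
    by_contra h
    exact hsD (hDadj d hd s ⟨hsU, h1, h⟩ hds)
  have hSc : G.IsClique (S : Set V) := by
    intro s hs t ht hst
    obtain ⟨hsU, hsD, d, hd, hds⟩ := Finset.mem_filter.1 hs
    obtain ⟨htU, htD, e, he, het⟩ := Finset.mem_filter.1 ht
    obtain ⟨-, p, hp⟩ := Finset.mem_filter.1 hd
    obtain ⟨-, q, hq⟩ := Finset.mem_filter.1 he
    refine hG.adj_of_walk (hSx s hs).2 (hSx t ht).2 hst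
      (Walk.cons hds.symm ((p.reverse.append q).concat het)) fun v hv => ?_
    simp only [Walk.support_cons, Walk.support_concat, List.mem_cons, List.not_mem_nil,
      or_false, List.mem_append, Walk.mem_support_append_iff, Walk.support_reverse,
      List.mem_reverse] at hv
    have hT : T v → v ≠ x ∧ (G.Adj x v → v = s ∨ v = t) :=
      fun h => ⟨h.2.1, fun h' => (h.2.2 h').elim⟩
    rcases hv with rfl | (hv | hv) | rfl
    · exact ⟨(hSx v hs).1, fun _ => .inl rfl⟩
    · exact hT (hp v hv)
    · exact hT (hq v hv)
    · exact ⟨(hSx v ht).1, fun _ => .inr rfl⟩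
  have hDS : D ∪ S ⊂ U := by
    refine Finset.ssubset_iff_of_subset (Finset.union_subset (Finset.filter_subset _ _)
      (Finset.filter_subset _ _)) |>.2 ⟨x, hxU, fun h => ?_⟩
    rcases Finset.mem_union.1 h with h | h
    · exact (hDT x h).2.1 rfl
    · exact (hSx x h).1 rfl
  obtain ⟨d, hd, hdS, hsimp⟩ := ih _ hDS S (Finset.ssubset_iff_of_subset
    Finset.subset_union_right |>.2 ⟨y, Finset.mem_union_left _ hyD,
      fun h => (Finset.mem_filter.1 h).2.1 hyD⟩) hSc
  have hdD : d ∈ D := (Finset.mem_union.1 hd).resolve_right hdS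
  have hnb : ∀ a ∈ U, G.Adj d a → a ∈ D ∪ S := by
    intro a ha hda
    by_cases h : a ∈ D
    · exact Finset.mem_union_left _ h
    · exact Finset.mem_union_right _ (Finset.mem_filter.2 ⟨ha, h, d, hdD, hda⟩)
  refine ⟨d, (hDT d hdD).1, fun h => (hDT d hdD).2.2 (hxC d h (hDT d hdD).2.1), ?_⟩
  exact fun a ha b hb hda hdb => hsimp a (hnb a ha hda) b (hnb b hb hdb) hda hdb

/-- In a chordal graph, a clique each of whose vertices has a neighbour outside the clique is
dominated by an independent set disjoint from it. -/
theorem IsChordal.exists_isIndepSet_dominating (hG : G.IsChordal) (U : Finset V) :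
    ∀ C ⊆ U, G.IsClique (C : Set V) → (∀ c ∈ C, ∃ d ∈ U, d ∉ C ∧ G.Adj c d) →
      ∃ S ⊆ U, Disjoint S C ∧ G.IsIndepSet (S : Set V) ∧ ∀ c ∈ C, ∃ s ∈ S, G.Adj c s := by
  classical
  induction U using Finset.strongInduction with
  | H U ih =>
  intro C hCU hC hdom
  rcases C.eq_empty_or_nonempty with rfl | ⟨c₀, hc₀⟩
  · exact ⟨∅, by simp, by simp, by simp [IsIndepSet], by simp⟩
  obtain ⟨d₀, hd₀, hd₀C, -⟩ := hdom c₀ hc₀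
  obtain ⟨d, hdU, hdC, hd⟩ := hG.exists_simplicial U C
    ((Finset.ssubset_iff_of_subset hCU).2 ⟨d₀, hd₀, hd₀C⟩) hC
  -- If `d` has a neighbour `e` outside `C`, then `d` can be deleted, as `e` is adjacent to every
  -- vertex of `C` adjacent to `d`. Otherwise `d` joins the dominating set and is removed with its
  -- neighbours; the rest of `C` keeps its outside neighbours, none of which is adjacent to `d`.
  by_cases h : ∃ e ∈ U, e ∉ C ∧ G.Adj d e
  · obtain ⟨e, heU, heC, hde⟩ := h
    obtain ⟨S, hS, hSC, hSi, hSd⟩ := ih (U.erase d) (Finset.erase_ssubset hdU) C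
      (fun c hc => Finset.mem_erase.2 ⟨fun h => hdC (h ▸ hc), hCU hc⟩) hC (by
        intro c hc
        obtain ⟨f, hfU, hfC, hcf⟩ := hdom c hc
        by_cases hfd : f = d
        · subst hfd
          exact ⟨e, Finset.mem_erase.2 ⟨hde.ne', heU⟩, heC,
            hd c (hCU hc) e heU hcf.symm hde fun h => heC (h ▸ hc)⟩
        · exact ⟨f, Finset.mem_erase.2 ⟨hfd, hfU⟩, hfC, hcf⟩)
    exact ⟨S, hS.trans (Finset.erase_subset _ _), hSC, hSi, hSd⟩
  · push Not at h
    let N : V → Prop := fun v => ¬ G.Adj d v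
    obtain ⟨S, hS, hSC, hSi, hSd⟩ := ih ((U.erase d).filter N)
      ((Finset.filter_subset _ _).trans_ssubset (Finset.erase_ssubset hdU)) (C.filter N)
      (by
        intro c hc
        obtain ⟨hc, hn⟩ := Finset.mem_filter.1 hc
        exact Finset.mem_filter.2 ⟨Finset.mem_erase.2 ⟨fun h => hdC (h ▸ hc), hCU hc⟩, hn⟩)
      (hC.subset fun c hc => (Finset.mem_filter.1 (Finset.mem_coe.1 hc)).1) (by
        intro c hc
        obtain ⟨hc, hn⟩ := Finset.mem_filter.1 hc
        obtain ⟨f, hfU, hfC, hcf⟩ := hdom c hc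
        refine ⟨f, Finset.mem_filter.2 ⟨Finset.mem_erase.2 ⟨?_, hfU⟩, h f hfU hfC⟩,
          fun h => hfC (Finset.mem_filter.1 h).1, hcf⟩
        rintro rfl
        exact hn hcf.symm)
    have hSN : ∀ s ∈ S, s ∈ U ∧ ¬ G.Adj d s := fun s hs => by
      obtain ⟨h1, h2⟩ := Finset.mem_filter.1 (hS hs)
      exact ⟨(Finset.mem_erase.1 h1).2, h2⟩
    refine ⟨insert d S, ?_, ?_, ?_, ?_⟩
    · exact Finset.insert_subset hdU fun s hs => (hSN s hs).1
    · rw [Finset.disjoint_insert_left]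
      refine ⟨hdC, Finset.disjoint_left.2 fun s hs hsC => ?_⟩
      exact Finset.disjoint_left.1 hSC hs (Finset.mem_filter.2 ⟨hsC, (hSN s hs).2⟩)
    · rw [Finset.coe_insert, IsIndepSet, Set.pairwise_insert]
      exact ⟨hSi, fun s hs _ => ⟨(hSN s hs).2, fun h => (hSN s hs).2 h.symm⟩⟩
    · intro c hc
      by_cases hn : G.Adj d c
      · exact ⟨d, Finset.mem_insert_self _ _, hn.symm⟩
      · obtain ⟨s, hs, hcs⟩ := hSd c (Finset.mem_filter.2 ⟨hc, hn⟩)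
        exact ⟨s, Finset.mem_insert_of_mem hs, hcs⟩

end SimpleGraph

/-! ### Unmixed chordal graphs: closed neighbourhoods of simplicial vertices. -/

namespace SimpleGraph

variable {V : Type*} {G : SimpleGraph V}

/-- A vertex is simplicial if its neighbours are pairwise adjacent. -/
def IsSimplicial (G : SimpleGraph V) (v : V) : Prop :=
  ∀ a b, G.Adj v a → G.Adj v b → a ≠ b → G.Adj a b

/-- The vertices in the closed neighbourhood of a simplicial vertex are pairwise adjacent. -/
theorem IsSimplicial.adj {w a b : V} (hw : G.IsSimplicial w) (ha : a = w ∨ G.Adj w a)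
    (hb : b = w ∨ G.Adj w b) (hab : a ≠ b) : G.Adj a b := by
  rcases ha with rfl | ha <;> rcases hb with rfl | hb
  · exact (hab rfl).elim
  · exact hb
  · exact ha.symm
  · exact hw a b ha hb hab

/-- An independent set covered by the closed neighbourhoods of simplicial vertices in `T` has at
most as many elements as `T`. -/
theorem IsIndepSet.card_le_of_simplicial_cover {M T : Finset V} (hM : G.IsIndepSet (M : Set V))
    (h : ∀ u ∈ M, ∃ w ∈ T, G.IsSimplicial w ∧ (u = w ∨ G.Adj w u)) : M.card ≤ T.card := by
  classical
  choose! f hfT hfs hf using h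
  refine Finset.card_le_card_of_injOn f hfT fun a ha b hb hab => ?_
  by_contra hne
  exact hM ha hb hne ((hfs a ha).adj (hf a ha) (hab ▸ hf b hb) hne)

theorem minimal_isVertexCover_compl {M : Set V} (hM : Maximal G.IsIndepSet M) :
    Minimal G.IsVertexCover Mᶜ := by
  refine ⟨isVertexCover_compl.2 hM.1, fun C hC hCM => ?_⟩
  rw [Set.compl_subset_comm]
  exact hM.2 (isIndepSet_compl_iff_isVertexCover.2 hC) (Set.subset_compl_comm.1 hCM)

theorem IsIndepSet.exists_maximal [Finite V] {S : Set V} (hS : G.IsIndepSet S) :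
    ∃ M, S ⊆ M ∧ Maximal G.IsIndepSet M :=
  (Set.toFinite {T | G.IsIndepSet T}).exists_le_maximal hS

/-- Extend `S` to a maximal independent set: its complement and that of `M` are minimal vertex
covers, hence equal in size. The combinatorial part uses unmixedness through this inequality. -/
theorem IsUnmixed.card_le [Finite V] (hG : G.IsUnmixed) {S M : Finset V}
    (hS : G.IsIndepSet (S : Set V)) (hM : Maximal G.IsIndepSet (M : Set V)) :
    S.card ≤ M.card := by
  obtain ⟨T, hST, hT⟩ := hS.exists_maximal
  have h := hG _ _ (minimal_isVertexCover_compl hT) (minimal_isVertexCover_compl hM)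
  have h1 := Set.encard_add_encard_compl T
  have h2 := Set.encard_add_encard_compl (M : Set V)
  rw [← h2, h] at h1
  have h3 : T.encard = (M : Set V).encard :=
    WithTop.add_right_cancel (Set.encard_ne_top_iff.2 (Set.toFinite _)) h1
  have h4 := Set.encard_le_encard hST
  rw [h3, Set.encard_coe_eq_coe_finsetCard, Set.encard_coe_eq_coe_finsetCard] at h4
  exact_mod_cast h4

theorem IsIndepSet.exists_maximal_finset [Finite V] {S : Finset V}
    (hS : G.IsIndepSet (S : Set V)) :
    ∃ M : Finset V, S ⊆ M ∧ Maximal G.IsIndepSet (M : Set V) := by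
  obtain ⟨T, hST, hT⟩ := hS.exists_maximal
  have hf := Set.toFinite T
  exact ⟨hf.toFinset, by simpa using hST, by simpa using hT⟩

/-- Independent simplicial vertices extend to an independent set of simplicial vertices whose
closed neighbourhoods cover the closed neighbourhoods of all simplicial vertices. -/
theorem exists_isIndepSet_simplicial [Finite V] {W₀ : Finset V}
    (h₀ : G.IsIndepSet (W₀ : Set V)) (h₁ : ∀ w ∈ W₀, G.IsSimplicial w) :
    ∃ W : Finset V, W₀ ⊆ W ∧ G.IsIndepSet (W : Set V) ∧ (∀ w ∈ W, G.IsSimplicial w) ∧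
      ∀ s u, G.IsSimplicial s → (u = s ∨ G.Adj s u) → ∃ w ∈ W, u = w ∨ G.Adj w u := by
  classical
  obtain ⟨W, hW₀, hW⟩ := (Set.toFinite {W : Finset V | G.IsIndepSet (W : Set V) ∧
    ∀ w ∈ W, G.IsSimplicial w}).exists_le_maximal (⟨h₀, h₁⟩ :
      W₀ ∈ {W : Finset V | G.IsIndepSet (W : Set V) ∧ ∀ w ∈ W, G.IsSimplicial w})
  refine ⟨W, hW₀, hW.1.1, hW.1.2, fun s u hs hu => ?_⟩
  have key : ∃ w ∈ W, s = w ∨ G.Adj w s := by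
    by_contra! h
    refine (h s (hW.2 (y := insert s W) ⟨?_, ?_⟩ (Finset.subset_insert _ _)
      (Finset.mem_insert_self _ _))).1 rfl
    · rw [Finset.coe_insert, IsIndepSet, Set.pairwise_insert]
      exact ⟨hW.1.1, fun b hb _ => ⟨fun h' => (h b hb).2 h'.symm, (h b hb).2⟩⟩
    · intro w hw
      rcases Finset.mem_insert.1 hw with rfl | hw
      exacts [hs, hW.1.2 w hw]
  obtain ⟨w, hw, hsw⟩ := key
  refine ⟨w, hw, ?_⟩
  by_cases huw : u = w
  · exact .inl huw
  · exact .inr (hs.adj (hsw.imp Eq.symm Adj.symm) hu (Ne.symm huw))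

/-- In an unmixed chordal graph, each vertex lies in the closed neighbourhood of a simplicial
vertex. -/
theorem IsUnmixed.exists_isSimplicial [Finite V] (hU : G.IsUnmixed) (hG : G.IsChordal) (u : V) :
    ∃ s, G.IsSimplicial s ∧ (u = s ∨ G.Adj s u) := by
  classical
  have := Fintype.ofFinite V
  by_contra! hu
  obtain ⟨W, -, hWi, hWs, hWc⟩ := exists_isIndepSet_simplicial (G := G) (W₀ := ∅)
    (by simp [IsIndepSet]) (by simp)
  -- `B` is the set of vertices lying in no closed neighbourhood of a simplicial vertex.
  let B : Finset V := Finset.univ.filter fun v => ∀ w ∈ W, v ≠ w ∧ ¬ G.Adj w v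
  have hB : ∀ v, v ∈ B ↔ ∀ w ∈ W, v ≠ w ∧ ¬ G.Adj w v := fun v => by simp [B]
  have huB : u ∈ B := (hB u).2 fun w hw => hu w (hWs w hw)
  have hBs : ∀ v s, v ∈ B → G.IsSimplicial s → v ≠ s ∧ ¬ G.Adj s v := by
    intro v s hv hs
    by_contra! h
    obtain ⟨w, hw, hvw⟩ := hWc s v hs (or_iff_not_imp_left.2 h)
    exact hvw.elim ((hB v).1 hv w hw).1 ((hB v).1 hv w hw).2
  obtain ⟨b, hbB, -, hb⟩ := hG.exists_simplicial B ∅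
    (Finset.empty_ssubset.2 ⟨u, huB⟩) (by simp [IsClique])
  let C : Finset V := B.filter fun v => v = b ∨ G.Adj b v
  have hbC : b ∈ C := Finset.mem_filter.2 ⟨hbB, .inl rfl⟩
  have hCc : G.IsClique (C : Set V) := by
    intro x hx y hy hxy
    obtain ⟨hxB, hx⟩ := Finset.mem_filter.1 hx
    obtain ⟨hyB, hy⟩ := Finset.mem_filter.1 hy
    rcases hx with rfl | hx <;> rcases hy with rfl | hy
    exacts [(hxy rfl).elim, hy, hx.symm, hb x hxB y hyB hx hy hxy]
  -- No vertex of `C` is simplicial in `G`, so each has a neighbour outside the clique `C`. A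
  -- maximal independent set `M` containing the dominating set `S` therefore avoids `C`.
  obtain ⟨S, -, hSC, hSi, hSd⟩ := hG.exists_isIndepSet_dominating Finset.univ C
    (Finset.subset_univ _) hCc (by
      intro c hc
      by_contra! h
      have hcB := (Finset.mem_filter.1 hc).1
      refine (hBs c c hcB fun x y hx hy hxy => hCc ?_ ?_ hxy).1 rfl
      · by_contra hxC
        exact h x (Finset.mem_univ _) hxC hx
      · by_contra hyC
        exact h y (Finset.mem_univ _) hyC hy)
  obtain ⟨M, hSM, hM⟩ := hSi.exists_maximal_finset
  have hMC : ∀ c ∈ C, c ∉ M := by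
    intro c hc hcM
    obtain ⟨s, hs, hcs⟩ := hSd c hc
    exact hM.1 hcM (hSM hs) hcs.ne hcs
  have hMB : ∀ v ∈ M ∩ B, v ∈ M ∧ v ∈ B ∧ v ≠ b ∧ ¬ G.Adj b v := by
    intro v hv
    obtain ⟨hvM, hvB⟩ := Finset.mem_inter.1 hv
    have : v ∉ C := fun h => hMC v h hvM
    simp only [C, Finset.mem_filter, hvB, true_and, not_or] at this
    exact ⟨hvM, hvB, this⟩
  -- This set has `|W| + 1 + |M ∩ B|` elements, while `M` has at most `|W|` elements outside `B`; so
  -- it is larger than `M`, which is absurd.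
  have hind : G.IsIndepSet ((W ∪ insert b (M ∩ B) : Finset V) : Set V) := by
    have h1 : ∀ v ∈ insert b (M ∩ B), v ∈ B := by
      intro v hv
      rcases Finset.mem_insert.1 hv with rfl | hv
      exacts [hbB, (hMB v hv).2.1]
    rw [Finset.coe_union, IsIndepSet, Set.pairwise_union]
    refine ⟨hWi, ?_, fun w hw v hv _ => ⟨((hB v).1 (h1 v hv) w hw).2,
      fun h => ((hB v).1 (h1 v hv) w hw).2 h.symm⟩⟩
    rw [Finset.coe_insert, Set.pairwise_insert]
    exact ⟨hM.1.mono (by simp), fun v hv _ =>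
      ⟨(hMB v hv).2.2.2, fun h => (hMB v hv).2.2.2 h.symm⟩⟩
  have hle := hU.card_le hind hM
  have hdisj : Disjoint W (insert b (M ∩ B)) := by
    rw [Finset.disjoint_left]
    intro w hw h
    rcases Finset.mem_insert.1 h with rfl | h
    · exact ((hB w).1 hbB w hw).1 rfl
    · exact ((hB w).1 (hMB w h).2.1 w hw).1 rfl
  rw [Finset.card_union_of_disjoint hdisj,
    Finset.card_insert_of_notMem fun h => (hMB b h).2.2.1 rfl] at hle
  have hsplit := Finset.card_inter_add_card_sdiff M B
  have hA : (M \ B).card ≤ W.card := by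
    refine IsIndepSet.card_le_of_simplicial_cover (G := G)
      (hM.1.mono (by simp)) fun v hv => ?_
    have hvB := (Finset.mem_sdiff.1 hv).2
    rw [hB] at hvB
    push Not at hvB
    obtain ⟨w, hw, h⟩ := hvB
    exact ⟨w, hw, hWs w hw, or_iff_not_imp_left.2 h⟩
  omega

/-- In an unmixed chordal graph, closed neighbourhoods of simplicial vertices are equal or
disjoint. -/
theorem IsUnmixed.simplicial_eq_or_adj [Finite V] (hU : G.IsUnmixed) (hG : G.IsChordal)
    {s t z : V} (hs : G.IsSimplicial s) (ht : G.IsSimplicial t) (hzs : z = s ∨ G.Adj s z)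
    (hzt : z = t ∨ G.Adj t z) : s = t ∨ G.Adj s t := by
  classical
  have := Fintype.ofFinite V
  by_contra! hst
  obtain ⟨W, hW₀, hWi, hWs, hWc⟩ := exists_isIndepSet_simplicial (G := G) (W₀ := {s, t})
    (by
      rw [Finset.coe_insert, IsIndepSet, Set.pairwise_insert]
      simp only [Finset.coe_singleton, Set.pairwise_singleton, Set.mem_singleton_iff, true_and]
      rintro _ rfl _
      exact ⟨hst.2, fun h => hst.2 h.symm⟩) (by simp [hs, ht])
  have hsW : s ∈ W := hW₀ (by simp)
  have htW : t ∈ W := hW₀ (by simp)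
  obtain ⟨M, hzM, hM⟩ := IsIndepSet.exists_maximal_finset (G := G) (S := {z})
    (by simp [IsIndepSet])
  have hzM : z ∈ M := hzM (by simp)
  have hle := hU.card_le hWi hM
  -- The only vertex of `M` in the closed neighbourhood of `t` is `z`, which `s` covers too; so `t`
  -- is superfluous in covering `M`.
  have hlt : M.card ≤ (W.erase t).card := by
    refine IsIndepSet.card_le_of_simplicial_cover (G := G) hM.1 fun u hu => ?_
    by_cases hut : u = t ∨ G.Adj t u
    · have huz : u = z := by
        by_contra h
        exact hM.1 hu hzM h (ht.adj hut hzt h)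
      exact ⟨s, Finset.mem_erase.2 ⟨hst.1, hsW⟩, hs, huz ▸ hzs⟩
    · obtain ⟨r, hr, hru⟩ := hU.exists_isSimplicial hG u
      obtain ⟨w, hw, huw⟩ := hWc r u hr hru
      exact ⟨w, Finset.mem_erase.2 ⟨fun h => hut (h ▸ huw), hw⟩, hWs w hw, huw⟩
  have := Finset.card_erase_lt_of_mem htW
  omega

/-! ### Free vertices and facets of the clique complex. -/

theorem mem_cliqueComplex {s : Finset V} :
    s ∈ G.cliqueComplex ↔ s.Nonempty ∧ G.IsClique (s : Set V) := Iff.rfl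

theorem exists_isFacet_of_isClique [Finite V] {s : Finset V} (h : s.Nonempty)
    (hs : G.IsClique (s : Set V)) : ∃ F, s ⊆ F ∧ G.cliqueComplex.IsFacet F :=
  (Set.toFinite {F : Finset V | F ∈ G.cliqueComplex}).exists_le_maximal
    (mem_cliqueComplex.2 ⟨h, hs⟩)

/-- The facet containing a free vertex is its closed neighbourhood. -/
theorem mem_iff_of_isFreeVertex [Finite V] {F : Finset V} (hF : G.cliqueComplex.IsFacet F)
    {x : V} (hxF : x ∈ F) (hx : G.cliqueComplex.IsFreeVertex x) (y : V) :
    y ∈ F ↔ y = x ∨ G.Adj x y := by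
  classical
  constructor
  · intro hy
    by_cases h : y = x
    · exact .inl h
    · exact .inr ((mem_cliqueComplex.1 hF.1).2 hxF hy (Ne.symm h))
  · rintro (rfl | h)
    · exact hxF
    · obtain ⟨E, hE, hEF⟩ := exists_isFacet_of_isClique (G := G) (s := {x, y}) (by simp)
        (by simpa using fun _ => h)
      rw [hx.unique ⟨hF, hxF⟩ ⟨hEF, hE (by simp)⟩]
      exact hE (by simp)

theorem isSimplicial_of_isFreeVertex [Finite V] {x : V} (hx : G.cliqueComplex.IsFreeVertex x) :
    G.IsSimplicial x := by
  obtain ⟨F, hF, hxF⟩ := hx.exists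
  have key := mem_iff_of_isFreeVertex hF hxF hx
  exact fun a b ha hb hab => (mem_cliqueComplex.1 hF.1).2 ((key a).2 (.inr ha))
    ((key b).2 (.inr hb)) hab

/-- A facet containing a simplicial vertex has a free vertex. -/
theorem IsSimplicial.exists_mem_freeFacets [Finite V] {x : V} (hx : G.IsSimplicial x) :
    ∃ F ∈ G.cliqueComplex.freeFacets, ∀ y, y ∈ F ↔ y = x ∨ G.Adj x y := by
  classical
  have := Fintype.ofFinite V
  let N : Finset V := Finset.univ.filter fun y => y = x ∨ G.Adj x y
  have hN : ∀ y, y ∈ N ↔ y = x ∨ G.Adj x y := fun y => by simp [N]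
  have hxN : x ∈ N := (hN x).2 (.inl rfl)
  have hNc : N ∈ G.cliqueComplex :=
    mem_cliqueComplex.2 ⟨⟨x, hxN⟩, fun a ha b hb h => hx.adj ((hN a).1 ha) ((hN b).1 hb) h⟩
  have hsub : ∀ E ∈ G.cliqueComplex, x ∈ E → E ⊆ N := by
    intro E hE hxE y hy
    rw [hN]
    by_cases h : y = x
    · exact .inl h
    · exact .inr ((mem_cliqueComplex.1 hE).2 hxE hy (Ne.symm h))
  have hNF : G.cliqueComplex.IsFacet N := ⟨hNc, fun E hE hNE => hsub E hE (hNE hxN)⟩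
  exact ⟨N, ⟨hNF, x, hxN, N, ⟨hNF, hxN⟩, fun E hE =>
    hE.1.eq_of_le hNc (hsub E hE.1.1 hE.2)⟩, hN⟩

/-- The facets with a free vertex of an unmixed chordal graph partition the vertex set. -/
theorem IsUnmixed.freeFacets_partition [Finite V] (hU : G.IsUnmixed) (hG : G.IsChordal) :
    G.cliqueComplex.freeFacets.PairwiseDisjoint id ∧
      (⋃ F ∈ G.cliqueComplex.freeFacets, (F : Set V)) = Set.univ := by
  constructor
  · rintro E ⟨hE, x, hxE, hx⟩ F ⟨hF, y, hyF, hy⟩ hEF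
    rw [Function.onFun, id, id, Finset.disjoint_left]
    intro z hzE hzF
    have hE' := mem_iff_of_isFreeVertex hE hxE hx
    have hF' := mem_iff_of_isFreeVertex hF hyF hy
    have hxy := hU.simplicial_eq_or_adj hG (isSimplicial_of_isFreeVertex hx)
      (isSimplicial_of_isFreeVertex hy) ((hE' z).1 hzE) ((hF' z).1 hzF)
    exact hEF (hx.unique ⟨hE, hxE⟩ ⟨hF, (hF' x).2 (hxy.imp id Adj.symm)⟩)
  · refine Set.eq_univ_of_forall fun u => ?_
    obtain ⟨s, hs, hus⟩ := hU.exists_isSimplicial hG u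
    obtain ⟨F, hF, hF'⟩ := hs.exists_mem_freeFacets
    exact Set.mem_biUnion hF ((hF' u).2 hus)

/-! ### Clique partitions with a private vertex in each clique, and hybrid graphs. -/

/-- The vertex set is partitioned into cliques `c ⁻¹' {i}`, each containing a vertex `b i` without
neighbours outside of it. -/
def IsCliqueWhiskered (G : SimpleGraph V) {m : ℕ} (c : V → Fin m) (b : Fin m → V) : Prop :=
  (∀ i, c (b i) = i) ∧ (∀ u v, c u = c v → u ≠ v → G.Adj u v) ∧ ∀ i v, G.Adj (b i) v → c v = i

theorem exists_isCliqueWhiskered_of_freeFacets [Finite V]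
    (h₁ : G.cliqueComplex.freeFacets.PairwiseDisjoint id)
    (h₂ : (⋃ F ∈ G.cliqueComplex.freeFacets, (F : Set V)) = Set.univ) :
    ∃ (m : ℕ) (c : V → Fin m) (b : Fin m → V), G.IsCliqueWhiskered c b := by
  classical
  obtain ⟨m, ⟨e⟩⟩ := Finite.exists_equiv_fin G.cliqueComplex.freeFacets
  have hc : ∀ u, ∃ i, u ∈ (e.symm i).1 := by
    intro u
    have hu : u ∈ (⋃ F ∈ G.cliqueComplex.freeFacets, (F : Set V)) := h₂ ▸ Set.mem_univ u
    simp only [Set.mem_iUnion, Finset.mem_coe, exists_prop] at hu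
    obtain ⟨F, hF, hu⟩ := hu
    exact ⟨e ⟨F, hF⟩, by simpa using hu⟩
  choose c hc using hc
  have hcu : ∀ u i, u ∈ (e.symm i).1 → c u = i := by
    intro u i hu
    have := h₁.elim_finset (e.symm (c u)).2 (e.symm i).2 u (hc u) hu
    exact e.symm.injective (Subtype.ext this)
  choose b hbF hb using fun i => (e.symm i).2.2
  refine ⟨m, c, b, fun i => hcu _ _ (hbF i), fun u v huv hne => ?_, fun i v hv => ?_⟩
  · exact (mem_cliqueComplex.1 (e.symm (c u)).2.1.1).2 (hc u) (huv ▸ hc v) hne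
  · exact hcu _ _ ((mem_iff_of_isFreeVertex (e.symm i).2.1 (hbF i) (hb i) v).2 (.inr hv))

/-- Each `B_i` is the singleton `{b i}`, and `H` is induced on the remaining vertices; an edge of
`G` between different cliques cannot involve any `b i`. -/
theorem IsCliqueWhiskered.isHybrid [Finite V] {m : ℕ} {c : V → Fin m} {b : Fin m → V}
    (h : G.IsCliqueWhiskered c b) : G.IsHybrid := by
  classical
  obtain ⟨hcb, hcl, hb⟩ := h
  obtain ⟨n, ⟨e⟩⟩ := Finite.exists_equiv_fin {v : V // v ≠ b (c v)}
  let f : V → Fin n ⊕ (Σ _ : Fin m, Fin 1) := fun v =>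
    if hv : v = b (c v) then .inr ⟨c v, 0⟩ else .inl (e ⟨v, hv⟩)
  let g : Fin n ⊕ (Σ _ : Fin m, Fin 1) → V := Sum.elim (fun a => (e.symm a).1) fun y => b y.1
  let E : V ≃ Fin n ⊕ (Σ _ : Fin m, Fin 1) :=
    { toFun := f
      invFun := g
      left_inv := by
        intro v
        by_cases hv : v = b (c v)
        · simp only [f, dif_pos hv, g, Sum.elim_inr]
          exact hv.symm
        · simp [f, dif_neg hv, g]
      right_inv := by
        rintro (a | ⟨i, j⟩)
        · have := (e.symm a).2
          simp [g, f, dif_neg this]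
        · obtain rfl := Subsingleton.elim j 0
          simp [g, f, hcb] }
  let H : SimpleGraph (Fin n) := G.comap fun a => (e.symm a).1
  let A : Fin m → Set (Fin n) := fun i => {a | c (e.symm a).1 = i}
  have hblock : ∀ x i, x ∈ hybridBlock A (fun _ => 1) i ↔ c (g x) = i := by
    rintro (a | y) i
    · simp [hybridBlock, g, A]
    · simp [hybridBlock, g, hcb]
  refine ⟨n, H, m, A, fun _ => 1, ⟨?_, ?_, ?_⟩, fun _ => one_pos, ⟨⟨E, ?_⟩⟩⟩
  · intro i x hx y hy hxy
    exact hcl _ _ (hx.trans hy.symm) fun h => hxy (e.symm.injective (Subtype.ext h))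
  · intro i j hij
    rw [Set.disjoint_left]
    exact fun x hx hy => hij (hx.symm.trans hy)
  · exact Set.eq_univ_of_forall fun a => Set.mem_iUnion.2 ⟨_, rfl⟩
  · intro u v
    obtain ⟨x, rfl⟩ := E.symm.surjective u
    obtain ⟨y, rfl⟩ := E.symm.surjective v
    rw [E.apply_symm_apply, E.apply_symm_apply]
    change (hybridGraph H A fun _ => 1).Adj x y ↔ G.Adj (g x) (g y)
    constructor
    · rintro (⟨a, d, rfl, rfl, h⟩ | ⟨hne, i, hx, hy⟩)
      · exact h
      · exact hcl _ _ (((hblock x i).1 hx).trans ((hblock y i).1 hy).symm)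
          fun h => hne (E.symm.injective h)
    · intro h
      have hne : x ≠ y := fun h' => h.ne (congrArg g h')
      by_cases hc : c (g x) = c (g y)
      · exact .inr ⟨hne, _, (hblock x _).2 rfl, (hblock y _).2 hc.symm⟩
      · rcases x with x | x
        · rcases y with y | y
          · exact .inl ⟨x, y, rfl, rfl, h⟩
          · exact (hc ((hb y.1 _ h.symm).trans (hcb _).symm)).elim
        · exact (hc ((hcb _).trans (hb x.1 _ h).symm)).elim

theorem IsHybrid.exists_isCliqueWhiskered (h : G.IsHybrid) :
    ∃ (m : ℕ) (c : V → Fin m) (b : Fin m → V), G.IsCliqueWhiskered c b := by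
  obtain ⟨n, H, r, A, s, ⟨hA, hd, hU⟩, hs, ⟨f⟩⟩ := h
  have hc : ∀ x : Fin n ⊕ (Σ i : Fin r, Fin (s i)), ∃ i, x ∈ hybridBlock A s i := by
    rintro (a | y)
    · have : a ∈ ⋃ i, A i := hU ▸ Set.mem_univ a
      obtain ⟨i, hi⟩ := Set.mem_iUnion.1 this
      exact ⟨i, .inl ⟨a, hi, rfl⟩⟩
    · exact ⟨y.1, .inr ⟨y, rfl, rfl⟩⟩
  choose c hc using hc
  have hcu : ∀ x i, x ∈ hybridBlock A s i → c x = i := by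
    rintro x i (⟨a, ha, rfl⟩ | ⟨y, hy, rfl⟩)
    · rcases hc (.inl a) with ⟨a', ha', h⟩ | ⟨y, -, h⟩
      · obtain rfl := Sum.inl_injective h
        by_contra hne
        exact Set.disjoint_left.1 (hd _ _ hne) ha' ha
      · exact (Sum.inr_ne_inl h).elim
    · rcases hc (.inr y) with ⟨a', -, h⟩ | ⟨y', hy', h⟩
      · exact (Sum.inl_ne_inr h).elim
      · obtain rfl := Sum.inr_injective h
        exact hy'.symm.trans hy
  refine ⟨r, fun v => c (f v), fun i => f.symm (.inr ⟨i, ⟨0, hs i⟩⟩), ?_, ?_, ?_⟩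
  · intro i
    change c (f (f.symm _)) = i
    rw [RelIso.apply_symm_apply]
    exact hcu _ _ (.inr ⟨_, rfl, rfl⟩)
  · intro u v huv hne
    rw [← f.map_rel_iff]
    exact .inr ⟨fun h => hne (f.injective h), c (f v),
      (show c (f u) = c (f v) from huv) ▸ hc (f u), hc _⟩
  · intro i v hv
    rw [← f.map_rel_iff, RelIso.apply_symm_apply] at hv
    rcases hv with ⟨x, y, h, -⟩ | ⟨-, j, hi, hj⟩
    · exact (Sum.inr_ne_inl h).elim
    · have h1 := hcu _ _ hi
      have h2 : c (.inr ⟨i, ⟨0, hs i⟩⟩) = i := hcu _ _ (.inr ⟨_, rfl, rfl⟩)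
      exact (hcu _ _ hj).trans (h1.symm.trans h2)

end SimpleGraph

/-! ### Bounding regular sequences by dimensions at associated primes. -/

section Depth

open RingTheory.Sequence IsLocalRing

/-- Nakayama: a nonzero submodule `N` of a finite module that contains `y` whenever it contains
`x • y` is not contained in `x M`. -/
theorem exists_mem_notMem_pointwise_smul_top {R M : Type*} [CommRing R] [IsLocalRing R]
    [IsNoetherianRing R] [AddCommGroup M] [Module R M] [Module.Finite R M] {x : R}
    (hx : x ∈ maximalIdeal R) {N : Submodule R M} (hN : N ≠ ⊥)
    (h : ∀ y, x • y ∈ N → y ∈ N) : ∃ y ∈ N, ∀ z, y ≠ x • z := by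
  by_contra! hc
  refine hN (Submodule.eq_bot_of_le_smul_of_le_jacobson_bot (maximalIdeal R) N
    (IsNoetherian.noetherian N) (fun y hy => ?_) (maximalIdeal_le_jacobson _))
  obtain ⟨z, rfl⟩ := hc y hy
  exact Submodule.smul_mem_smul hx (h z hy)

/-- The length of a regular sequence is at most the dimension of `R ⧸ p` for any associated
prime `p`. -/
theorem RingTheory.Sequence.IsWeaklyRegular.length_le_ringKrullDim_quotient {R : Type u}
    [CommRing R] [IsLocalRing R] [IsNoetherianRing R] (rs : List R)
    (hrs : ∀ r ∈ rs, r ∈ maximalIdeal R) :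
    ∀ {M : Type v} [AddCommGroup M] [Module R M] [Module.Finite R M], IsWeaklyRegular M rs →
      ∀ p ∈ associatedPrimes R M, (rs.length : WithBot ℕ∞) ≤ ringKrullDim (R ⧸ p) := by
  induction rs with
  | nil =>
    intro M _ _ _ _ p hp
    have := hp.isPrime
    simpa using ringKrullDim_nonneg_of_nontrivial
  | cons x rs ih =>
    intro M _ _ _ hM p hp
    rw [isWeaklyRegular_cons_iff] at hM
    obtain ⟨hx, hM⟩ := hM
    obtain ⟨hpp, m, hm⟩ := isAssociatedPrime_iff.1 hp
    have hxm : x ∈ maximalIdeal R := hrs x (by simp)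
    have hm' : ∀ a, a ∈ p ↔ a • m = 0 := fun a => by
      rw [hm, Submodule.mem_colon_singleton, Submodule.mem_bot]
    have hxp : x ∉ p := by
      intro h
      have h0 : m = 0 := hx (by simpa using (hm' x).1 h)
      exact hpp.ne_top (Ideal.eq_top_iff_one _ |>.2 ((hm' 1).2 (by simp [h0])))
    -- `N` consists of the elements killed by `p`. Nakayama gives `y ∈ N` outside `xM`; its class in
    -- `M/xM` is killed by `p` and by `x`, so an associated prime `q` of `M/xM` contains both. Since
    -- `x ∉ p`, `dim R/q + 1 ≤ dim R/p`.
    let N := Submodule.torsionBySet R M (p : Set R)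
    have hN : ∀ y, y ∈ N ↔ ∀ a ∈ p, a • y = 0 := fun y => by
      rw [Submodule.mem_torsionBySet_iff]
      simp
    have hN0 : N ≠ ⊥ := by
      intro h
      have h0 : m ∈ N := (hN m).2 fun a ha => (hm' a).1 ha
      rw [h, Submodule.mem_bot] at h0
      exact hpp.ne_top (Ideal.eq_top_iff_one _ |>.2 ((hm' 1).2 (by simp [h0])))
    obtain ⟨y, hy, hyx⟩ := exists_mem_notMem_pointwise_smul_top hxm hN0 fun z hz => by
      rw [hN] at hz ⊢
      intro a ha
      refine hx ?_
      simp only [smul_zero]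
      rw [smul_comm, hz a ha]
    have hy0 : (Submodule.Quotient.mk y : QuotSMulTop x M) ≠ 0 := by
      rw [Ne, Submodule.Quotient.mk_eq_zero, Submodule.mem_smul_pointwise_iff_exists]
      rintro ⟨z, -, hz⟩
      exact hyx z hz.symm
    obtain ⟨q, hq, hyq⟩ := exists_le_isAssociatedPrime_of_isNoetherianRing R _ hy0
    have hann : ∀ a : R, a • (Submodule.Quotient.mk y : QuotSMulTop x M) = 0 → a ∈ q :=
      fun a ha => hyq (by rw [Submodule.mem_colon_singleton, Submodule.mem_bot, ha])
    have hpq : p ≤ q := fun a ha => hann a (by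
      rw [← Submodule.Quotient.mk_smul, (hN y).1 hy a ha, Submodule.Quotient.mk_zero])
    have hxq : x ∈ q := hann x (by
      rw [← Submodule.Quotient.mk_smul, Submodule.Quotient.mk_eq_zero]
      exact Submodule.smul_mem_pointwise_smul _ _ _ trivial)
    have hle := ih (fun r hr => hrs r (by simp [hr])) hM q hq
    have hdim := ringKrullDim_succ_le_of_surjective (Ideal.Quotient.factor hpq)
      (Ideal.Quotient.factor_surjective hpq) (r := Ideal.Quotient.mk p x)
      (mem_nonZeroDivisors_of_ne_zero (by rwa [Ne, Ideal.Quotient.eq_zero_iff_mem]))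
      (by rwa [Ideal.Quotient.factor_mk, Ideal.Quotient.eq_zero_iff_mem])
    refine le_trans ?_ hdim
    push_cast [List.length_cons]
    gcongr

end Depth

/-! ### Dimension bounds by counting surviving variables. -/

section Dimension

open MvPolynomial

variable {V k : Type*} [Field k] [Finite V]

/-- A quotient of a polynomial ring has dimension at most the number of variables that do not
vanish in it. -/
theorem ringKrullDim_mvPolynomial_quotient_le (J : Ideal (MvPolynomial V k)) :
    ringKrullDim (MvPolynomial V k ⧸ J) ≤ Nat.card {i : V // X i ∉ J} := by
  let f : MvPolynomial {i : V // X i ∉ J} k →ₐ[k] MvPolynomial V k ⧸ J :=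
    aeval fun i => Ideal.Quotient.mk J (X i.1)
  have hf : Function.Surjective f := by
    rw [← AlgHom.range_eq_top, eq_top_iff]
    have h1 : (Ideal.Quotient.mkₐ k J).range = ⊤ :=
      (AlgHom.range_eq_top _).2 (Ideal.Quotient.mkₐ_surjective k J)
    rw [← h1, ← Algebra.map_top, ← adjoin_range_X, AlgHom.map_adjoin, Algebra.adjoin_le_iff]
    rintro _ ⟨_, ⟨i, rfl⟩, rfl⟩
    by_cases hi : X i ∈ J
    · have : Ideal.Quotient.mkₐ k J (X i) = 0 := Ideal.Quotient.eq_zero_iff_mem.2 hi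
      rw [this]
      exact zero_mem _
    · exact ⟨X ⟨i, hi⟩, aeval_X _ _⟩
  refine (ringKrullDim_le_of_surjective f.toRingHom hf).trans ?_
  rw [MvPolynomial.ringKrullDim_of_isNoetherianRing, ringKrullDim_eq_zero_of_field, zero_add]

/-- Chains of primes above `q` contract to strict chains above `q.comap φ`. This covers
localizations of edge rings, which need not be quotients of the polynomial ring. -/
theorem ringKrullDim_quotient_le_card_of_comap_injective {A : Type*} [CommRing A]
    (φ : MvPolynomial V k →+* A) (hφ : Function.Injective (PrimeSpectrum.comap φ)) (q : Ideal A) :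
    ringKrullDim (A ⧸ q) ≤ Nat.card {i : V // φ (X i) ∉ q} := by
  refine le_trans ?_ (ringKrullDim_mvPolynomial_quotient_le (q.comap φ))
  rw [ringKrullDim_quotient, ringKrullDim_quotient]
  refine Order.krullDim_le_of_strictMono
    (fun P : PrimeSpectrum.zeroLocus (q : Set A) => (⟨PrimeSpectrum.comap φ P.1, fun x hx =>
      P.2 hx⟩ : PrimeSpectrum.zeroLocus (q.comap φ : Set (MvPolynomial V k)))) ?_
  refine Monotone.strictMono_of_injective (fun P Q h x hx => h hx) fun P Q h => ?_
  exact Subtype.ext (hφ (congrArg Subtype.val h))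

end Dimension

/-! ### Cohen–Macaulay implies unmixed. -/

namespace SimpleGraph

open MvPolynomial IsLocalRing

variable {V : Type*} {k : Type*} [Field k] {G : SimpleGraph V}

theorem edgeIdeal_le_ker {B : Type*} [CommRing B] (φ : MvPolynomial V k →+* B)
    (h : ∀ i j, G.Adj i j → φ (X i) * φ (X j) = 0) : ∀ a ∈ G.edgeIdeal k, φ a = 0 := by
  intro a ha
  have : G.edgeIdeal k ≤ RingHom.ker φ := by
    refine Ideal.span_le.2 ?_
    rintro _ ⟨i, j, hij, rfl⟩
    simpa [RingHom.mem_ker] using h i j hij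
  exact this ha

/-- Substituting zero for the variables in `C`. -/
noncomputable def killVars (k : Type*) [Field k] (C : Set V) :
    MvPolynomial V k →ₐ[k] MvPolynomial V k :=
  open scoped Classical in aeval fun i => if i ∈ C then 0 else X i

theorem killVars_X_of_mem {C : Set V} {i : V} (h : i ∈ C) : killVars k C (X i) = 0 := by
  simp [killVars, h]

theorem killVars_X_of_notMem {C : Set V} {i : V} (h : i ∉ C) : killVars k C (X i) = X i := by
  simp [killVars, h]

theorem killVars_killVars {C D : Set V} (h : C ⊆ D) (f : MvPolynomial V k) :
    killVars k D (killVars k C f) = killVars k D f := by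
  have : (killVars k D).comp (killVars k C) = killVars k D := by
    refine MvPolynomial.algHom_ext fun i => ?_
    by_cases hC : i ∈ C
    · simp [killVars_X_of_mem hC, killVars_X_of_mem (h hC)]
    · simp [killVars_X_of_notMem hC]
  exact DFunLike.congr_fun this f

theorem constantCoeff_killVars (C : Set V) (f : MvPolynomial V k) :
    constantCoeff (killVars k C f) = constantCoeff f := by
  have : (constantCoeff.comp (killVars k C).toRingHom) = constantCoeff := by
    refine MvPolynomial.ringHom_ext (fun r => by simp [killVars]) fun i => ?_
    by_cases hC : i ∈ C
    · simp [killVars_X_of_mem hC]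
    · simp [killVars_X_of_notMem hC]
  exact DFunLike.congr_fun this f

/-- Substituting zero for the variables in a vertex cover, as a map on the quotient by the edge
ideal. -/
noncomputable def coverHom (k : Type*) [Field k] {C : Set V} (hC : G.IsVertexCover C) :
    MvPolynomial V k ⧸ G.edgeIdeal k →+* MvPolynomial V k :=
  Ideal.Quotient.lift _ (killVars k C).toRingHom (edgeIdeal_le_ker _ fun i j hij => by
    rcases hC hij with h | h
    · simp [killVars_X_of_mem h]
    · simp [killVars_X_of_mem h])

/-- The prime ideal generated by the variables in a vertex cover. -/
noncomputable def coverPrime (k : Type*) [Field k] {C : Set V} (hC : G.IsVertexCover C) :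
    PrimeSpectrum (MvPolynomial V k ⧸ G.edgeIdeal k) :=
  ⟨RingHom.ker (coverHom k hC), RingHom.ker_isPrime _⟩

theorem mk_mem_coverPrime {C : Set V} (hC : G.IsVertexCover C) (f : MvPolynomial V k) :
    Ideal.Quotient.mk _ f ∈ (coverPrime k hC).asIdeal ↔ killVars k C f = 0 := Iff.rfl

theorem mk_X_mem_coverPrime {C : Set V} (hC : G.IsVertexCover C) (i : V) :
    Ideal.Quotient.mk _ (X i) ∈ (coverPrime k hC).asIdeal ↔ i ∈ C := by
  rw [mk_mem_coverPrime]
  by_cases h : i ∈ C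
  · simp [killVars_X_of_mem h, h]
  · simp [killVars_X_of_notMem h, h]

theorem coverPrime_le {C D : Set V} (hC : G.IsVertexCover C) (hD : G.IsVertexCover D)
    (h : C ⊆ D) : coverPrime k hC ≤ coverPrime k hD := by
  intro f hf
  obtain ⟨f, rfl⟩ := Ideal.Quotient.mk_surjective f
  rw [mk_mem_coverPrime] at hf ⊢
  rw [← killVars_killVars h, hf, map_zero]

theorem coverPrime_lt {C D : Set V} (hC : G.IsVertexCover C) (hD : G.IsVertexCover D)
    (h : C ⊂ D) : coverPrime k hC < coverPrime k hD := by
  obtain ⟨i, hiD, hiC⟩ := Set.exists_of_ssubset h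
  refine lt_of_le_not_ge (coverPrime_le hC hD h.1) fun h' => hiC ?_
  exact (mk_X_mem_coverPrime hC i).1 (h' ((mk_X_mem_coverPrime hD i).2 hiD))

/-- Evaluation at zero on the quotient by the edge ideal. -/
noncomputable def constantCoeffHom (G : SimpleGraph V) (k : Type*) [Field k] :
    MvPolynomial V k ⧸ G.edgeIdeal k →+* k :=
  Ideal.Quotient.lift _ constantCoeff (edgeIdeal_le_ker _ fun i j _ => by simp)

instance isMaximal_ker_constantCoeffHom : (RingHom.ker (constantCoeffHom G k)).IsMaximal :=
  RingHom.ker_isMaximal_of_surjective _ fun r =>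
    ⟨Ideal.Quotient.mk _ (C r), by simp [constantCoeffHom]⟩

theorem coverPrime_le_ker_constantCoeffHom {C : Set V} (hC : G.IsVertexCover C) :
    (coverPrime k hC).asIdeal ≤ RingHom.ker (constantCoeffHom G k) := by
  intro f hf
  obtain ⟨f, rfl⟩ := Ideal.Quotient.mk_surjective f
  rw [mk_mem_coverPrime] at hf
  change constantCoeff f = 0
  rw [← constantCoeff_killVars C, hf, map_zero]

/-- The irrelevant maximal ideal has height at least the number of vertices outside a vertex
cover. -/
theorem card_compl_le_height [Finite V] {D : Set V} (hD : G.IsVertexCover D) :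
    (Nat.card {i // i ∉ D} : ℕ∞) ≤ (RingHom.ker (constantCoeffHom G k)).height := by
  obtain ⟨d, ⟨e⟩⟩ := Finite.exists_equiv_fin {i // i ∉ D}
  rw [Nat.card_congr e, Nat.card_fin]
  -- `S j` is `D` with the first `j` vertices outside it added: a strict chain of `d + 1` covers,
  -- hence of primes.
  let S : Fin (d + 1) → Set V := fun j => {v | ∀ h : v ∉ D, (e ⟨v, h⟩ : ℕ) < j}
  have hDS : ∀ j, D ⊆ S j := fun j v hv h => (h hv).elim
  have hS : ∀ i j : Fin (d + 1), i < j → S i ⊂ S j := by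
    intro i j hij
    have hi : (i : ℕ) < d := lt_of_lt_of_le (Fin.lt_def.1 hij) (Nat.lt_succ_iff.1 j.2)
    have hs := (e.symm ⟨i, hi⟩).2
    refine (Set.ssubset_iff_of_subset fun v hv h => (hv h).trans hij).2
      ⟨(e.symm ⟨i, hi⟩).1, fun h => ?_, fun h => ?_⟩
    · simpa using hij
    · simpa using h hs
  let l : LTSeries (PrimeSpectrum (MvPolynomial V k ⧸ G.edgeIdeal k)) :=
    LTSeries.mk d (fun j => coverPrime k (hD.subset (hDS j)))
      fun i j hij => coverPrime_lt _ _ (hS i j hij)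
  have hl : l.last ≤ ⟨RingHom.ker (constantCoeffHom G k), inferInstance⟩ :=
    coverPrime_le_ker_constantCoeffHom _
  exact (Order.length_le_height hl).trans (PrimeSpectrum.height_eq_orderHeight _).ge

/-- The local ring at the irrelevant maximal ideal has, for each minimal vertex cover `C`, an
associated prime whose quotient has dimension at most the number of vertices outside `C`. -/
theorem exists_associatedPrime_ringKrullDim_le [Finite V] {C : Set V}
    (hC : Minimal G.IsVertexCover C) (A : Type*) [CommRing A]
    [Algebra (MvPolynomial V k ⧸ G.edgeIdeal k) A]
    [IsLocalization.AtPrime A (RingHom.ker (constantCoeffHom G k))] [IsNoetherianRing A] :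
    ∃ q ∈ associatedPrimes A A, ringKrullDim (A ⧸ q) ≤ Nat.card {i // i ∉ C} := by
  let m := RingHom.ker (constantCoeffHom G k)
  let Q : Ideal A := (coverPrime k hC.1).asIdeal.map (algebraMap _ A)
  have hdisj : Disjoint (m.primeCompl : Set (MvPolynomial V k ⧸ G.edgeIdeal k))
      ((coverPrime k hC.1).asIdeal : Set (MvPolynomial V k ⧸ G.edgeIdeal k)) :=
    Set.disjoint_left.2 fun x hx hxC => hx (coverPrime_le_ker_constantCoeffHom hC.1 hxC)
  have hQ : Q.IsPrime := IsLocalization.isPrime_of_isPrime_disjoint m.primeCompl A _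
    (coverPrime k hC.1).2 hdisj
  have hQC : Q.comap (algebraMap _ A) = (coverPrime k hC.1).asIdeal :=
    IsLocalization.under_map_of_isPrime_disjoint m.primeCompl A (coverPrime k hC.1).2 hdisj
  obtain ⟨q, hq, hqQ⟩ := Ideal.exists_minimalPrimes_le (bot_le : ⊥ ≤ Q)
  have hqp : q.IsPrime := hq.1.1
  let φ : MvPolynomial V k →+* A :=
    (algebraMap (MvPolynomial V k ⧸ G.edgeIdeal k) A).comp (Ideal.Quotient.mk _)
  have hφ : Function.Injective (PrimeSpectrum.comap φ) := by
    rw [PrimeSpectrum.comap_comp]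
    exact (PrimeSpectrum.comap_injective_of_surjective _ Ideal.Quotient.mk_surjective).comp
      (PrimeSpectrum.localization_comap_injective A m.primeCompl)
  have hqC : ∀ i, φ (X i) ∈ q → i ∈ C := by
    intro i hi
    rw [← mk_X_mem_coverPrime (k := k) hC.1, ← hQC]
    exact hqQ hi
  -- The variables in the minimal prime `q` form a vertex cover inside `C`, hence exactly `C`;
  -- nothing else about `q` is needed. As a minimal prime, `q` is associated.
  have hcover : G.IsVertexCover {i | φ (X i) ∈ q} := by
    intro i j hij
    refine hqp.mem_or_mem ?_
    rw [← map_mul]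
    have : Ideal.Quotient.mk (G.edgeIdeal k) (X i * X j) = 0 :=
      Ideal.Quotient.eq_zero_iff_mem.2 (Ideal.subset_span ⟨i, j, hij, rfl⟩)
    simp only [φ, RingHom.comp_apply, this, map_zero, zero_mem]
  have hqC' : ∀ i, φ (X i) ∉ q ↔ i ∉ C := fun i =>
    not_congr ⟨hqC i, fun hi => hC.2 hcover hqC hi⟩
  have h2 := ringKrullDim_quotient_le_card_of_comap_injective φ hφ q
  rw [Nat.card_congr (Equiv.subtypeEquivRight hqC')] at h2
  exact ⟨q, Module.associatedPrimes.minimalPrimes_annihilator_subset_associatedPrimes A A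
    (by rwa [Module.annihilator_eq_bot.2 inferInstance]), h2⟩

/-- If `G` is Cohen-Macaulay over some field then all minimal vertex covers of `G` have the same
cardinality. -/
theorem IsCohenMacaulayOver.isUnmixed [Finite V] (h : G.IsCohenMacaulayOver k) :
    G.IsUnmixed := by
  suffices key : ∀ C D : Set V, Minimal G.IsVertexCover C → Minimal G.IsVertexCover D →
      Nat.card {i // i ∉ D} ≤ Nat.card {i // i ∉ C} by
    intro C D hC hD
    have h1 := Set.ncard_add_ncard_compl C
    have h2 := Set.ncard_add_ncard_compl D
    have h3 : Cᶜ.ncard = Dᶜ.ncard := le_antisymm (key D C hD hC) (key C D hC hD)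
    rw [← (Set.toFinite C).cast_ncard_eq, ← (Set.toFinite D).cast_ncard_eq]
    congr 1
    omega
  intro C D hC hD
  obtain ⟨-, hCM⟩ := h
  obtain ⟨hN, rs, hrs, hreg, hlen⟩ := hCM (RingHom.ker (constantCoeffHom G k))
  obtain ⟨q, hq, hqC⟩ := exists_associatedPrime_ringKrullDim_le (k := k) hC
    (Localization.AtPrime (RingHom.ker (constantCoeffHom G k)))
  -- With `A` the localization: `|V \ D| ≤ dim A = rs.length ≤ dim A/q ≤ |V \ C|`.
  have h1 := hreg.toIsWeaklyRegular.length_le_ringKrullDim_quotient rs hrs q hq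
  have h3 : ((Nat.card {i // i ∉ D} : ℕ∞) : WithBot ℕ∞) ≤
      (RingHom.ker (constantCoeffHom G k)).height :=
    WithBot.coe_le_coe.2 (card_compl_le_height (k := k) hD.1)
  rw [← IsLocalization.AtPrime.ringKrullDim_eq_height (RingHom.ker (constantCoeffHom G k))
    (Localization.AtPrime (RingHom.ker (constantCoeffHom G k))), ← hlen] at h3
  exact_mod_cast h3.trans (h1.trans hqC)

end SimpleGraph

/-! ### Weakly regular sequences: extensions of modules and monic polynomials. -/

section WeaklyRegular

open RingTheory.Sequence Polynomial

/-- The head `r` is regular on both ends, hence in the middle. Its regularity on `M₃` also keeps the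
sequence left exact modulo `r`, so induction applies. -/
theorem RingTheory.Sequence.IsWeaklyRegular.of_shortExact {R : Type u} [CommRing R] (rs : List R) :
    ∀ {M₁ M₂ M₃ : Type v} [AddCommGroup M₁] [AddCommGroup M₂] [AddCommGroup M₃]
      [Module R M₁] [Module R M₂] [Module R M₃] (f : M₁ →ₗ[R] M₂) (g : M₂ →ₗ[R] M₃),
      Function.Injective f → Function.Exact f g → Function.Surjective g →
      IsWeaklyRegular M₁ rs → IsWeaklyRegular M₃ rs → IsWeaklyRegular M₂ rs := by
  induction rs with
  | nil => intros; exact .nil _ _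
  | cons r rs ih =>
    intro M₁ M₂ M₃ _ _ _ _ _ _ f g hf hfg hg h₁ h₃
    rw [isWeaklyRegular_cons_iff] at h₁ h₃ ⊢
    obtain ⟨hr₁, h₁⟩ := h₁
    obtain ⟨hr₃, h₃⟩ := h₃
    refine ⟨isSMulRegular_of_range_eq_ker hf hfg.linearMap_ker_eq.symm hr₁ hr₃, ?_⟩
    refine ih (QuotSMulTop.map r f) (QuotSMulTop.map r g) ?_ (QuotSMulTop.map_exact r hfg hg)
      (QuotSMulTop.map_surjective r hg) h₁ h₃
    rw [injective_iff_map_eq_zero]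
    intro x hx
    obtain ⟨x, rfl⟩ := Submodule.Quotient.mk_surjective _ x
    rw [QuotSMulTop.map_apply_mk, Submodule.Quotient.mk_eq_zero,
      Submodule.mem_smul_pointwise_iff_exists] at hx
    obtain ⟨y, -, hy⟩ := hx
    have hgy : g y = 0 := hr₃ (by
      simp only [smul_zero]
      rw [← map_smul, hy, hfg.apply_apply_eq_zero])
    obtain ⟨z, rfl⟩ := (hfg y).1 hgy
    rw [Submodule.Quotient.mk_eq_zero, ← hf ((map_smul f r z).trans hy)]
    exact Submodule.smul_mem_pointwise_smul _ _ _ trivial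

/-- Modulo the extension of `J` one computes in `(B/J)[X]`, where the image of `q` is still monic,
hence a nonzerodivisor. -/
theorem Polynomial.Monic.mem_map_C_of_mul_mem {B : Type*} [CommRing B] {J : Ideal B} {q f : B[X]}
    (hq : q.Monic) (h : q * f ∈ J.map (C : B →+* B[X])) : f ∈ J.map (C : B →+* B[X]) := by
  have hker := Polynomial.ker_mapRingHom (Ideal.Quotient.mk J)
  rw [Ideal.mk_ker] at hker
  rw [← hker, RingHom.mem_ker, Polynomial.coe_mapRingHom] at h ⊢
  rw [Polynomial.map_mul] at h
  exact ((hq.map _).mul_right_eq_zero_iff).1 h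

/-- Monic polynomials, one in each variable, form a weakly regular sequence. -/
theorem MvPolynomial.isWeaklyRegular_aeval_X {k : Type*} [CommRing k] (m : ℕ) :
    ∀ p : Fin m → k[X], (∀ i, (p i).Monic) →
      IsWeaklyRegular (MvPolynomial (Fin m) k)
        ((List.finRange m).reverse.map
          fun i => Polynomial.aeval (MvPolynomial.X (R := k) i) (p i)) := by
  induction m with
  | zero => intro p hp; exact .nil _ _
  | succ m ih =>
    intro p hp
    let B := MvPolynomial (Fin m) k
    let rs : List B := (List.finRange m).reverse.map
      fun i => Polynomial.aeval (MvPolynomial.X (R := k) i) (p i.succ)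
    have hrs : IsWeaklyRegular B rs := ih (fun i => p i.succ) fun i => hp _
    have h1 : IsWeaklyRegular B[X] (rs.map (algebraMap B B[X])) := hrs.of_flat
    -- Variable `0` becomes the polynomial variable over `B`. The reversed list puts its entry last,
    -- after those coming from `B`, which stay weakly regular by flatness.
    have h2 : IsWeaklyRegular B[X]
        (rs.map (algebraMap B B[X]) ++ [(p 0).map (algebraMap k B)]) := by
      rw [isWeaklyRegular_append_iff]
      refine ⟨h1, (isWeaklyRegular_singleton_iff _ _).2 ?_⟩
      rw [isSMulRegular_quotient_iff_mem_of_smul_mem]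
      intro f hf
      rw [← Ideal.map_ofList, smul_eq_mul, Ideal.mul_top] at hf ⊢
      exact ((hp 0).map _).mem_map_C_of_mul_mem hf
    let e := MvPolynomial.finSuccEquiv k m
    refine (AddEquiv.isWeaklyRegular_congr (e := e.toAddEquiv) (bs := List.map e _)
      (List.forall₂_map_right_iff.2 <| List.forall₂_same.2 fun r _ x => map_mul e r x)).2 ?_
    convert h2 using 1
    rw [List.finRange_succ, List.reverse_cons, List.map_append, List.map_append, List.map_singleton,
      List.map_singleton, ← List.map_reverse, List.map_map, List.map_map, List.map_map]
    congr 1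
    · refine List.map_congr_left fun i _ => ?_
      rw [Function.comp_apply, Function.comp_apply, ← Polynomial.aeval_algHom_apply,
        MvPolynomial.finSuccEquiv_X_succ, ← Polynomial.algebraMap_eq,
        Polynomial.aeval_algebraMap_apply]
      rfl
    · rw [← Polynomial.aeval_algHom_apply, MvPolynomial.finSuccEquiv_X_zero,
        Polynomial.aeval_X_left_eq_map]

end WeaklyRegular

/-! ### Edge ideals of induced subgraphs and the exact sequence of a vertex. -/

namespace SimpleGraph

open MvPolynomial RingTheory.Sequence

variable {V : Type u} {k : Type v} [Field k] {G : SimpleGraph V}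

/-- The edge ideal together with the variables outside of `U`; the quotient by it is the edge ring
of the subgraph induced on `U`. -/
noncomputable def inducedEdgeIdeal (G : SimpleGraph V) (k : Type*) [Field k] (U : Set V) :
    Ideal (MvPolynomial V k) :=
  G.edgeIdeal k ⊔ Ideal.span (X '' Uᶜ)

theorem X_mem_inducedEdgeIdeal {U : Set V} {i : V} (hi : i ∉ U) :
    X i ∈ G.inducedEdgeIdeal k U :=
  Ideal.mem_sup_right (Ideal.subset_span ⟨i, hi, rfl⟩)

theorem X_mul_X_mem_inducedEdgeIdeal (U : Set V) {i j : V} (h : G.Adj i j) :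
    X i * X j ∈ G.inducedEdgeIdeal k U :=
  Ideal.mem_sup_left (Ideal.subset_span ⟨i, j, h, rfl⟩)

theorem inducedEdgeIdeal_le {U : Set V} {J : Ideal (MvPolynomial V k)}
    (h₁ : ∀ i j, G.Adj i j → X i * X j ∈ J) (h₂ : ∀ i ∉ U, X i ∈ J) :
    G.inducedEdgeIdeal k U ≤ J := by
  refine sup_le (Ideal.span_le.2 ?_) (Ideal.span_le.2 ?_)
  · rintro _ ⟨i, j, h, rfl⟩
    exact h₁ i j h
  · rintro _ ⟨i, hi, rfl⟩
    exact h₂ i hi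

theorem inducedEdgeIdeal_univ : G.inducedEdgeIdeal k Set.univ = G.edgeIdeal k := by
  simp [inducedEdgeIdeal]

/-- The ideal is generated by monomials, so membership is tested on each monomial of `f`. -/
theorem mem_inducedEdgeIdeal {U : Set V} {f : MvPolynomial V k} :
    f ∈ G.inducedEdgeIdeal k U ↔ ∀ s ∈ f.support,
      (∃ i j, G.Adj i j ∧ Finsupp.single i 1 + Finsupp.single j 1 ≤ s) ∨ ∃ i ∉ U, s i ≠ 0 := by
  have h : G.inducedEdgeIdeal k U = Ideal.span ((fun s => monomial s (1 : k)) ''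
      ({s | ∃ i j, G.Adj i j ∧ s = Finsupp.single i 1 + Finsupp.single j 1} ∪
        (fun i => Finsupp.single i 1) '' Uᶜ)) := by
    rw [Set.image_union, Ideal.span_union, Set.image_image]
    have he : {p : MvPolynomial V k | ∃ i j, G.Adj i j ∧ p = X i * X j} =
        (fun s => monomial s (1 : k)) ''
          {s | ∃ i j, G.Adj i j ∧ s = Finsupp.single i 1 + Finsupp.single j 1} := by
      have hX : ∀ i j : V, (X i * X j : MvPolynomial V k) =
          monomial (Finsupp.single i 1 + Finsupp.single j 1) 1 := fun i j => by
        rw [X, X, monomial_mul, one_mul]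
      refine Set.Subset.antisymm ?_ ?_
      · rintro _ ⟨i, j, hij, rfl⟩
        exact ⟨_, ⟨i, j, hij, rfl⟩, (hX i j).symm⟩
      · rintro _ ⟨_, ⟨i, j, hij, rfl⟩, rfl⟩
        exact ⟨i, j, hij, (hX i j).symm⟩
    rw [inducedEdgeIdeal, edgeIdeal, he]
    rfl
  rw [h, mem_ideal_span_monomial_image]
  refine forall₂_congr fun s _ => ?_
  constructor
  · rintro ⟨_, ⟨i, j, hij, rfl⟩ | ⟨i, hi, rfl⟩, hs⟩
    · exact .inl ⟨i, j, hij, hs⟩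
    · exact .inr ⟨i, hi, by simpa [Nat.one_le_iff_ne_zero] using hs⟩
  · rintro (⟨i, j, hij, hs⟩ | ⟨i, hi, hs⟩)
    · exact ⟨_, .inl ⟨i, j, hij, rfl⟩, hs⟩
    · exact ⟨_, .inr ⟨i, hi, rfl⟩, by simpa [Nat.one_le_iff_ne_zero] using hs⟩

/-- The colon ideal of `inducedEdgeIdeal` by a variable. -/
theorem X_mul_mem_inducedEdgeIdeal {U : Set V} {v : V} (hv : v ∈ U) {f : MvPolynomial V k} :
    X v * f ∈ G.inducedEdgeIdeal k U ↔ f ∈ G.inducedEdgeIdeal k (U \ {w | G.Adj v w}) := by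
  classical
  constructor
  · rw [mem_inducedEdgeIdeal, mem_inducedEdgeIdeal]
    intro h s hs
    have hs' : Finsupp.single v 1 + s ∈ (X v * f).support := by
      rw [mem_support_iff, coeff_X_mul]
      exact mem_support_iff.1 hs
    -- If the edge dividing `X v` times the monomial `s` passes through `v`, its other end divides
    -- `s` and is one of the variables added to the ideal.
    have hN : ∀ w, G.Adj v w → s w ≠ 0 → ∃ i ∉ U \ {w | G.Adj v w}, s i ≠ 0 :=
      fun w hw hsw => ⟨w, fun h' => h'.2 hw, hsw⟩
    rcases h _ hs' with ⟨i, j, hij, hle⟩ | ⟨i, hi, hne⟩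
    · have hi := hle i
      have hj := hle j
      simp only [Finsupp.add_apply, Finsupp.single_apply, if_true, hij.ne, hij.ne',
        if_false] at hi hj
      by_cases hiv : v = i
      · subst hiv
        simp only [hij.ne, if_false] at hj
        exact .inr (hN j hij (by omega))
      · by_cases hjv : v = j
        · subst hjv
          simp only [hiv, if_false] at hi
          exact .inr (hN i hij.symm (by omega))
        · refine .inl ⟨i, j, hij, fun w => ?_⟩
          have hw := hle w
          simp only [Finsupp.add_apply, Finsupp.single_apply] at hw ⊢
          by_cases hvw : v = w
          · subst hvw
            simp [Ne.symm hiv, Ne.symm hjv]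
          · simpa [hvw] using hw
    · have hiv : v ≠ i := fun h' => hi (h' ▸ hv)
      refine .inr ⟨i, fun h' => hi h'.1, ?_⟩
      simpa [Finsupp.single_apply, hiv] using hne
  · intro hf
    have hle : G.inducedEdgeIdeal k (U \ {w | G.Adj v w}) ≤
        Submodule.comap (LinearMap.mulLeft (MvPolynomial V k) (X v))
          (G.inducedEdgeIdeal k U) := by
      refine inducedEdgeIdeal_le (fun i j hij => ?_) fun i hi => ?_
      · exact (G.inducedEdgeIdeal k U).mul_mem_left (X v) (X_mul_X_mem_inducedEdgeIdeal U hij)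
      · by_cases hvi : G.Adj v i
        · exact X_mul_X_mem_inducedEdgeIdeal U hvi
        · exact (G.inducedEdgeIdeal k U).mul_mem_left (X v)
            (X_mem_inducedEdgeIdeal fun h => hi ⟨h, hvi⟩)
    exact hle hf

/-- Weak regularity passes from the deletion and the link of a vertex to the graph. -/
theorem isWeaklyRegular_inducedEdgeIdeal_of_vertex {U : Set V} {v : V} (hv : v ∈ U)
    (rs : List (MvPolynomial V k))
    (h₁ : IsWeaklyRegular (MvPolynomial V k ⧸ G.inducedEdgeIdeal k (U \ {w | G.Adj v w})) rs)
    (h₂ : IsWeaklyRegular (MvPolynomial V k ⧸ G.inducedEdgeIdeal k (U \ {v})) rs) :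
    IsWeaklyRegular (MvPolynomial V k ⧸ G.inducedEdgeIdeal k U) rs := by
  have hle : G.inducedEdgeIdeal k U ≤ G.inducedEdgeIdeal k (U \ {v}) :=
    inducedEdgeIdeal_le (fun i j h => X_mul_X_mem_inducedEdgeIdeal _ h)
      fun i hi => X_mem_inducedEdgeIdeal fun h => hi h.1
  -- With `S` the polynomial ring and `I` the ideal of `U`, this is `0 → S/(I : X v) → S/I → S/(I +
  -- (X v)) → 0`, the first map being multiplication by `X v`.
  let f := Submodule.mapQ (G.inducedEdgeIdeal k (U \ {w | G.Adj v w})) (G.inducedEdgeIdeal k U)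
    (LinearMap.mulLeft (MvPolynomial V k) (X v)) fun f hf => (X_mul_mem_inducedEdgeIdeal hv).2 hf
  let g := Submodule.factor hle
  refine IsWeaklyRegular.of_shortExact rs f g ?_ ?_ (Submodule.factor_surjective hle) h₁ h₂
  · rw [injective_iff_map_eq_zero]
    intro x hx
    obtain ⟨x, rfl⟩ := Submodule.Quotient.mk_surjective _ x
    have hx : X v * x ∈ G.inducedEdgeIdeal k U := (Submodule.Quotient.mk_eq_zero _).1 hx
    exact (Submodule.Quotient.mk_eq_zero _).2 ((X_mul_mem_inducedEdgeIdeal hv).1 hx)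
  · intro x
    obtain ⟨x, rfl⟩ := Submodule.Quotient.mk_surjective _ x
    constructor
    · intro hx
      have hx : x ∈ G.inducedEdgeIdeal k (U \ {v}) := (Submodule.Quotient.mk_eq_zero _).1 hx
      have hsup : G.inducedEdgeIdeal k (U \ {v}) ≤ G.inducedEdgeIdeal k U ⊔ Ideal.span {X v} := by
        refine inducedEdgeIdeal_le
          (fun i j h => Ideal.mem_sup_left (X_mul_X_mem_inducedEdgeIdeal U h)) fun i hi => ?_
        by_cases hiv : i = v
        · exact Ideal.mem_sup_right (hiv ▸ Ideal.subset_span rfl)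
        · exact Ideal.mem_sup_left (X_mem_inducedEdgeIdeal fun h => hi ⟨h, hiv⟩)
      obtain ⟨y, hy, z, hz, rfl⟩ := Submodule.mem_sup.1 (hsup hx)
      obtain ⟨z, rfl⟩ := Ideal.mem_span_singleton'.1 hz
      refine ⟨Submodule.Quotient.mk z, ?_⟩
      refine (Submodule.Quotient.eq _).2 ?_
      rw [LinearMap.mulLeft_apply, mul_comm, ← neg_mem_iff]
      simpa using hy
    · rintro ⟨y, hy⟩
      obtain ⟨y, rfl⟩ := Submodule.Quotient.mk_surjective _ y
      rw [← hy]
      exact (Submodule.Quotient.mk_eq_zero _).2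
        (Ideal.mul_mem_right _ _ (X_mem_inducedEdgeIdeal (by simp)))

end SimpleGraph

/-! ### Whiskered clique partitions give Cohen–Macaulay edge rings. -/

theorem RingTheory.Sequence.IsRegular.length_le_ringKrullDim {A : Type*} [CommRing A]
    [IsLocalRing A] [IsNoetherianRing A] {rs : List A} (h : RingTheory.Sequence.IsRegular A rs) :
    (rs.length : WithBot ℕ∞) ≤ ringKrullDim A := by
  have hnt : Nontrivial (A ⧸ Ideal.ofList rs) := by
    rw [Ideal.Quotient.nontrivial_iff]
    intro h'
    apply h.2
    rw [h', smul_eq_mul, Ideal.mul_top]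
  rw [← ringKrullDim_add_length_eq_ringKrullDim_of_isRegular _ h]
  exact le_add_of_nonneg_left ringKrullDim_nonneg_of_nontrivial

namespace SimpleGraph

open MvPolynomial RingTheory.Sequence

variable {V : Type u} {k : Type v} [Field k] {G : SimpleGraph V}

open scoped Classical in
/-- The sum of the variables in a block. -/
noncomputable def blockSum (k : Type*) [Field k] [Fintype V] {m : ℕ} (c : V → Fin m) (i : Fin m) :
    MvPolynomial V k :=
  ∑ v with c v = i, X v

/-- Monic polynomials evaluated at the block sums form a weakly regular sequence when only one
vertex per block is left. -/
theorem isWeaklyRegular_of_transversal [Fintype V] {m : ℕ} {c : V → Fin m} {b : Fin m → V}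
    {U : Set V} (hbU : ∀ i, b i ∈ U) (hcb : ∀ i, c (b i) = i)
    (hN : ∀ i, ∀ v ∈ U, G.Adj (b i) v → c v = i) (hU : ∀ v ∈ U, v = b (c v))
    (p : Fin m → Polynomial k) (hp : ∀ i, (p i).Monic) :
    IsWeaklyRegular (MvPolynomial V k ⧸ G.inducedEdgeIdeal k U)
      ((List.finRange m).reverse.map fun i => Polynomial.aeval (blockSum k c i) (p i)) := by
  classical
  -- `U` is now the independent set of all `b i`, so `ψ` identifies the quotient with a polynomial
  -- ring in `m` variables and sends the `i`-th block sum to `X i`.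
  let ψ : MvPolynomial V k →ₐ[k] MvPolynomial (Fin m) k :=
    aeval fun v => if v = b (c v) then X (c v) else 0
  have hψb : ∀ i, ψ (X (b i)) = X i := fun i => by simp [ψ, hcb]
  have hψ0 : ∀ v, v ≠ b (c v) → ψ (X v) = 0 := fun v hv => by simp [ψ, hv]
  have hψsum : ∀ i, ψ (blockSum k c i) = X i := by
    intro i
    rw [blockSum, map_sum, Finset.sum_eq_single (b i), hψb]
    · intro v hv hne
      refine hψ0 v fun h => hne ?_
      rwa [(Finset.mem_filter.1 hv).2] at h
    · intro h
      exact (h (by simp [hcb])).elim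
  have hsurj : Function.Surjective ψ := fun f => by
    refine ⟨rename b f, ?_⟩
    have : ψ.comp (rename b) = AlgHom.id k _ :=
      MvPolynomial.algHom_ext fun i => by
        simp only [AlgHom.comp_apply, rename_X, hψb, AlgHom.id_apply]
    exact DFunLike.congr_fun this f
  have hker : G.inducedEdgeIdeal k U = RingHom.ker ψ.toRingHom := by
    refine le_antisymm (inducedEdgeIdeal_le (fun i j hij => ?_) fun i hi => ?_) fun f hf => ?_
    · change ψ (X i * X j) = 0
      rw [map_mul]
      by_cases hi : i = b (c i)
      · by_cases hj : j = b (c j)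
        · have h : c j = c i := hN (c i) j (hj ▸ hbU _) (hi ▸ hij)
          rw [h, ← hi] at hj
          exact (hij.ne hj.symm).elim
        · rw [hψ0 j hj, mul_zero]
      · rw [hψ0 i hi, zero_mul]
    · exact hψ0 i fun h => hi (h ▸ hbU _)
    · have : (Ideal.Quotient.mkₐ k (G.inducedEdgeIdeal k U)).comp ((rename b).comp ψ) =
          Ideal.Quotient.mkₐ k (G.inducedEdgeIdeal k U) := by
        refine MvPolynomial.algHom_ext fun v => ?_
        rw [AlgHom.comp_apply, AlgHom.comp_apply]
        by_cases hv : v = b (c v)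
        · conv_lhs => rw [hv, hψb, rename_X, ← hv]
        · rw [hψ0 v hv, map_zero, map_zero]
          exact (Ideal.Quotient.eq_zero_iff_mem.2
            (X_mem_inducedEdgeIdeal fun h => hv (hU v h))).symm
      have h := DFunLike.congr_fun this f
      have hf : ψ f = 0 := hf
      rw [AlgHom.comp_apply, AlgHom.comp_apply, hf, map_zero, map_zero] at h
      exact Ideal.Quotient.eq_zero_iff_mem.1 h.symm
  rw [hker]
  have hreg := MvPolynomial.isWeaklyRegular_aeval_X m p hp
  have hlist : (List.finRange m).reverse.map (fun i => Polynomial.aeval (X (R := k) i) (p i)) =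
      ((List.finRange m).reverse.map
        fun i => Polynomial.aeval (blockSum k c i) (p i)).map ψ := by
    rw [List.map_map]
    refine List.map_congr_left fun i _ => ?_
    rw [Function.comp_apply, ← Polynomial.aeval_algHom_apply, hψsum]
  rw [hlist] at hreg
  let e := RingHom.quotientKerEquivOfSurjective (f := ψ.toRingHom) hsurj
  refine (AddEquiv.isWeaklyRegular_congr (e := e.toAddEquiv)
    (List.forall₂_map_right_iff.2 <| List.forall₂_same.2 fun r _ x => ?_)).2 hreg
  obtain ⟨x, rfl⟩ := Ideal.Quotient.mk_surjective x
  exact map_mul ψ r x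

/-- Induction on `|U|`. Both sets in the exact sequence of a vertex `v ≠ b (c v)` still contain a
private vertex of every block, so `b` must vary with `U`; the base case is a transversal. The
sequence itself never changes. -/
theorem isWeaklyRegular_inducedEdgeIdeal [Fintype V] {m : ℕ} {c : V → Fin m}
    (hc : ∀ u v, c u = c v → u ≠ v → G.Adj u v) (p : Fin m → Polynomial k)
    (hp : ∀ i, (p i).Monic) (n : ℕ) : ∀ (U : Set V) (b : Fin m → V), U.ncard = n →
      (∀ i, b i ∈ U) → (∀ i, c (b i) = i) → (∀ i, ∀ v ∈ U, G.Adj (b i) v → c v = i) →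
      IsWeaklyRegular (MvPolynomial V k ⧸ G.inducedEdgeIdeal k U)
        ((List.finRange m).reverse.map fun i => Polynomial.aeval (blockSum k c i) (p i)) := by
  classical
  induction n using Nat.strong_induction_on with
  | _ n ih =>
  intro U b hn hbU hcb hN
  by_cases hU : ∀ v ∈ U, v = b (c v)
  · exact isWeaklyRegular_of_transversal hbU hcb hN hU p hp
  push Not at hU
  obtain ⟨v, hv, hvb⟩ := hU
  refine isWeaklyRegular_inducedEdgeIdeal_of_vertex hv _ ?_ ?_
  -- Removing the neighbours of `v` removes `b (c v)` but isolates `v`, which becomes the private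
  -- vertex of its block; the other `b i` are not adjacent to `v`.
  · refine ih _ ?_ _ (Function.update b (c v) v) rfl (fun i => ?_) (fun i => ?_) fun i w hw h => ?_
    · rw [← hn]
      refine Set.ncard_lt_ncard ((Set.ssubset_iff_of_subset Set.sdiff_subset).2
        ⟨b (c v), hbU _, fun h => h.2 (hc _ _ (hcb _).symm hvb)⟩) (Set.toFinite _)
    · by_cases hi : i = c v
      · subst hi
        simp [hv]
      · rw [Function.update_of_ne hi]
        exact ⟨hbU i, fun h => hi (hN i v hv h.symm).symm⟩
    · by_cases hi : i = c v
      · subst hi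
        simp
      · rw [Function.update_of_ne hi, hcb]
    · by_cases hi : i = c v
      · subst hi
        rw [Function.update_self] at h
        exact (hw.2 h).elim
      · rw [Function.update_of_ne hi] at h
        exact hN i w hw.1 h
  · refine ih _ ?_ _ b rfl (fun i => ⟨hbU i, ?_⟩) hcb fun i w hw => hN i w hw.1
    · rw [← hn]
      exact Set.ncard_lt_ncard ((Set.ssubset_iff_of_subset Set.sdiff_subset).2
        ⟨v, hv, fun h => h.2 rfl⟩) (Set.toFinite _)
    · rintro rfl
      exact hvb (congrArg b (hcb i)).symm

/-- The localizations of the edge ring have dimension at most the number of blocks. -/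
theorem ringKrullDim_le_of_cliques [Finite V] {m : ℕ} {c : V → Fin m}
    (hc : ∀ u v, c u = c v → u ≠ v → G.Adj u v) (A : Type*) [CommRing A]
    [Algebra (MvPolynomial V k ⧸ G.edgeIdeal k) A]
    (M : Submonoid (MvPolynomial V k ⧸ G.edgeIdeal k)) [IsLocalization M A] :
    ringKrullDim A ≤ m := by
  let φ : MvPolynomial V k →+* A :=
    (algebraMap (MvPolynomial V k ⧸ G.edgeIdeal k) A).comp (Ideal.Quotient.mk _)
  have hφ : Function.Injective (PrimeSpectrum.comap φ) := by
    rw [PrimeSpectrum.comap_comp]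
    exact (PrimeSpectrum.comap_injective_of_surjective _ Ideal.Quotient.mk_surjective).comp
      (PrimeSpectrum.localization_comap_injective A M)
  refine iSup_le fun l => ?_
  -- A chain is no longer than `dim A/q` for its least prime `q`. Two variables of one block have
  -- product zero, so at most one per block lies outside `q`.
  let q := l.head
  let l' : LTSeries (PrimeSpectrum.zeroLocus (q.asIdeal : Set A)) :=
    LTSeries.mk l.length (fun j => ⟨l j, LTSeries.head_le l j⟩) fun i j hij => l.strictMono hij
  have h1 : (l.length : WithBot ℕ∞) ≤ ringKrullDim (A ⧸ q.asIdeal) := by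
    rw [ringKrullDim_quotient]
    exact le_iSup (fun s : LTSeries _ => (s.length : WithBot ℕ∞)) l'
  refine h1.trans ((ringKrullDim_quotient_le_card_of_comap_injective φ hφ _).trans ?_)
  have hcard : Nat.card {i : V // φ (X i) ∉ q.asIdeal} ≤ Nat.card (Fin m) := by
    refine Nat.card_le_card_of_injective (fun i => c i.1) fun i j hij => ?_
    by_contra hne
    have hadj := hc i.1 j.1 hij fun h => hne (Subtype.ext h)
    have h0 : φ (X i.1) * φ (X j.1) = 0 := by
      have : Ideal.Quotient.mk (G.edgeIdeal k) (X i.1 * X j.1) = 0 :=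
        Ideal.Quotient.eq_zero_iff_mem.2 (Ideal.subset_span ⟨i.1, j.1, hadj, rfl⟩)
      rw [← map_mul]
      simp only [φ, RingHom.comp_apply, this, map_zero]
    exact (q.2.mem_or_mem (h0 ▸ zero_mem _ : φ (X i.1) * φ (X j.1) ∈ q.asIdeal)).elim i.2 j.2
  rw [Nat.card_fin] at hcard
  exact_mod_cast hcard

theorem IsCliqueWhiskered.isCohenMacaulayOver [Finite V] {m : ℕ} {c : V → Fin m} {b : Fin m → V}
    (h : G.IsCliqueWhiskered c b) (k : Type*) [Field k] : G.IsCohenMacaulayOver k := by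
  have := Fintype.ofFinite V
  obtain ⟨hcb, hc, hb⟩ := h
  have hnoeth : IsNoetherianRing (MvPolynomial V k ⧸ G.edgeIdeal k) := inferInstance
  refine ⟨hnoeth, fun M hM => ⟨inferInstance, ?_⟩⟩
  let R := MvPolynomial V k ⧸ G.edgeIdeal k
  let : Field (R ⧸ M) := Ideal.Quotient.field M
  have hfin : Module.Finite k (R ⧸ M) := finite_of_finite_type_of_isJacobsonRing k (R ⧸ M)
  let π : MvPolynomial V k →ₐ[k] R ⧸ M :=
    (Ideal.Quotient.mkₐ k M).comp (Ideal.Quotient.mkₐ k (G.edgeIdeal k))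
  -- Block sums need not lie in `M`. Their residues are algebraic over `k` by the Nullstellensatz,
  -- and the minimal polynomials, being monic, evaluate at the block sums to a weakly regular
  -- sequence inside `M`.
  let p : Fin m → Polynomial k := fun i => minpoly k (π (blockSum k c i))
  have hp : ∀ i, (p i).Monic := fun i => minpoly.monic (Algebra.IsIntegral.isIntegral _)
  let rs : List (MvPolynomial V k) :=
    (List.finRange m).reverse.map fun i => Polynomial.aeval (blockSum k c i) (p i)
  have hrs : IsWeaklyRegular R rs := by
    have := isWeaklyRegular_inducedEdgeIdeal (k := k) hc p hp _ Set.univ b rfl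
      (fun _ => Set.mem_univ _) hcb fun i v _ => hb i v
    rwa [inducedEdgeIdeal_univ] at this
  have hrsR : IsWeaklyRegular R (rs.map (algebraMap (MvPolynomial V k) R)) :=
    (isWeaklyRegular_map_algebraMap_iff R R rs).2 hrs
  have hmem : ∀ r ∈ rs.map (algebraMap (MvPolynomial V k) R), r ∈ M := by
    intro r hr
    obtain ⟨s, hs, rfl⟩ := List.mem_map.1 hr
    obtain ⟨i, -, rfl⟩ := List.mem_map.1 hs
    refine Ideal.Quotient.eq_zero_iff_mem.1 ?_
    change π (Polynomial.aeval (blockSum k c i) (p i)) = 0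
    rw [← Polynomial.aeval_algHom_apply, minpoly.aeval]
  have hreg := hrsR.isRegular_of_isLocalization_of_mem (Localization.AtPrime M) M hmem
  refine ⟨_, fun r hr => ?_, hreg, le_antisymm ?_ ?_⟩
  · obtain ⟨s, hs, rfl⟩ := List.mem_map.1 hr
    exact (IsLocalization.AtPrime.to_map_mem_maximal_iff _ M s).2 (hmem s hs)
  · exact hreg.length_le_ringKrullDim
  · refine (ringKrullDim_le_of_cliques hc (Localization.AtPrime M) M.primeCompl).trans ?_
    simp [rs]

end SimpleGraph

/-! ### The equivalence. -/

theorem corollary2p8 (K : Type u) [Field K] (n : ℕ) (G : SimpleGraph (Fin n))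
    (hG : G.IsChordal) :
    List.TFAE [
      SimpleGraph.IsCohenMacaulay.{v} G,
      G.IsCohenMacaulayOver K,
      G.IsUnmixed,
      G.cliqueComplex.freeFacets.PairwiseDisjoint id ∧
        (⋃ F ∈ G.cliqueComplex.freeFacets, (F : Set (Fin n))) = Set.univ,
      G.IsHybrid] := by
  -- A single field suffices; `ULift` places `ℚ` in the universe over which condition 1 quantifies.
  tfae_have 1 → 3 := fun h => (h (ULift.{v} ℚ)).isUnmixed
  tfae_have 2 → 3 := fun h => h.isUnmixed
  tfae_have 3 → 4 := fun h => h.freeFacets_partition hG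
  tfae_have 4 → 5 := fun h => by
    obtain ⟨m, c, b, hcb⟩ := SimpleGraph.exists_isCliqueWhiskered_of_freeFacets h.1 h.2
    exact hcb.isHybrid
  tfae_have 5 → 1 := fun h k _ => by
    obtain ⟨m, c, b, hcb⟩ := h.exists_isCliqueWhiskered
    exact hcb.isCohenMacaulayOver k
  tfae_have 5 → 2 := fun h => by
    obtain ⟨m, c, b, hcb⟩ := h.exists_isCliqueWhiskered
    exact hcb.isCohenMacaulayOver K
  tfae_finish
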